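/- Let $\mathbb K$ be a field. An arrangement $(\mathcal A,V)$ is a finite (possibly empty) set $\mathcal A$ of linear hyperplanes in a finite-dimensional $\mathbb K$-vector space $V$. Its lattice $L(\mathcal A)$ is the set of all intersections of subsets of $\mathcal A$ (including $V$, the empty intersection). For $X\in L(\mathcal A)$ put $\mathcal A_X=\{H\in\mathcal A : X\subseteq H\}$, and let $\mathcal A^X=\{X\cap H : H\in\mathcal A\setminus\mathcal A_X\}$, an arrangement in $X$. The product of $(\mathcal A_1,V_1)$ and $(\mathcal A_2,V_2)$ is the arrangement $\mathcal A_1\times\mathcal A_2=\{H_1\oplus V_2 : H_1\in\mathcal A_1\}\cup\{V_1\oplus H_2 : H_2\in\mathcal A_2\}$ in $V_1\oplus V_2$. A partition $\pi=(\pi_1,\dots,\pi_s)$ of $\mathcal A$ into non-empty blocks is a factorization of $\mathcal A$ if (i) for any choice of $H_i\in\pi_i$ ($1\le i\le s$) the subspace $H_1\cap\dots\cap H_s$ has codimension $s$ in $V$, and (ii) for each $X\in L(\mathcal A)\setminus\{V\}$ some $\pi_i\cap\mathcal A_X$ is a singleton. $\mathcal A$ is factored if it admits a factorization. The class of inductive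 factorizations is the smallest class of pairs $(\mathcal A,\pi)$, with $\pi$ a partition of the arrangement $\mathcal A$, such that: it contains the empty arrangement in each $V$ with the empty partition; and it contains $(\mathcal A,\pi)$ whenever there are a block of $\pi$, say $\pi_1$, and an $H_0\in\pi_1$ for which the map $\mathcal A\setminus\pi_1\to\mathcal A^{H_0}$, $H\mapsto H\cap H_0$, is a well-defined bijection and both of the following pairs are in the class: $\mathcal A\setminus\{H_0\}$ with the partition into the non-empty sets $\pi_i\setminus\{H_0\}$, and $\mathcal A^{H_0}$ with the partition into the sets $\{H\cap H_0 : H\in\pi_i\}$, $i\ne 1$. $\mathcal A$ is inductively factored if $(\mathcal A,\pi)$ is in this class for some $\pi$. $\mathcal A$ is hereditarily factored (respectively hereditarily inductively factored) if $\mathcal A^X$ is factored (respectively inductively factored) for every $X\in L(\mathcal A)$. Let $S=S(V^*)$ be the symmetric algebra of $V^*$ and $D(\mathcal A)$ the $S$-module of $\mathbb K$-derivations $\theta$ of $S$ with $\theta(\alpha)\in\alpha S$ for every $\alpha\in V^*$ with $\ker\alpha\in\mathcal A$. A derivation is homogeneous of polynomial degree $d$ if it maps $V^*$ into $S_d$.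 $\mathcal A$ is free with multiset of exponents $\exp\mathcal A$ if $D(\mathcal A)$ has a basis over $S$ consisting of homogeneous derivations; $\exp\mathcal A$ is then the multiset of their polynomial degrees, which is the same for every such basis. Let $\mathcal A_1,\mathcal A_2$ be two arrangements over $\mathbb K$ and $\mathcal A=\mathcal A_1\times\mathcal A_2$. 1. $\mathcal A$ is hereditarily factored if and only if both $\mathcal A_1$ and $\mathcal A_2$ are hereditarily factored. 2. $\mathcal A$ is hereditarily inductively factored if and only if both $\mathcal A_1$ and $\mathcal A_2$ are hereditarily inductively factored. 3. If $\mathcal A$ is inductively factored (in particular, if it is hereditarily inductively factored), then $\mathcal A_1$, $\mathcal A_2$ and $\mathcal A$ are free, and $\exp\mathcal A$ is the multiset union, with multiplicities added, of $\exp\mathcal A_1$ and $\exp\mathcal A_2$. -/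

import Mathlib

universe u v w

/-- A (central) hyperplane arrangement in the `K`-vector space `V`: a finite collection of linear
hyperplanes, i.e. of maximal proper linear subspaces of `V`. -/
structure HyperplaneArrangement (K : Type w) (V : Type u) [Field K] [AddCommGroup V]
    [Module K V] where
  /-- the hyperplanes of the arrangement -/
  hyperplanes : Set (Submodule K V)
  finite : hyperplanes.Finite
  isCoatom : ∀ H ∈ hyperplanes, IsCoatom H

/-- `P` is (the set of blocks of) a partition of the set `s`: the blocks are non-empty, pairwise
disjoint, and their union is `s`. The only partition of `∅` is the empty one. -/
structure IsPartitionOf {α : Type u} (P : Set (Set α)) (s : Set α) : Prop where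
  empty_notMem : ∅ ∉ P
  pairwiseDisjoint : P.PairwiseDisjoint id
  sUnion_eq : ⋃₀ P = s

/-- The partition induced by `P` on a subset `t`: the non-empty sets of the form `B ∩ t` with `B`
a block of `P`. -/
def inducedPartition {α : Type u} (P : Set (Set α)) (t : Set α) : Set (Set α) :=
  {C | C.Nonempty ∧ ∃ B ∈ P, C = B ∩ t}

namespace HyperplaneArrangement

section Basic

variable {K : Type w} [Field K] {V : Type u} [AddCommGroup V] [Module K V]

/-- The empty arrangement in `V`. -/
def empty (K : Type w) [Field K] (V : Type u) [AddCommGroup V] [Module K V] :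
    HyperplaneArrangement K V where
  hyperplanes := ∅
  finite := Set.finite_empty
  isCoatom := by simp

/-- The lattice `L(A)`: all intersections of subfamilies of `A`; the empty intersection is `V`. -/
def lattice (A : HyperplaneArrangement K V) : Set (Submodule K V) :=
  {X | ∃ T ⊆ A.hyperplanes, X = sInf T}

/-- The hyperplanes of the localization `A_X`: the members of `A` that contain `X`. -/
def localization (A : HyperplaneArrangement K V) (X : Submodule K V) : Set (Submodule K V) :=
  {H ∈ A.hyperplanes | X ≤ H}

/-- `X ∩ H`, as a subspace of the vector space `X`. -/
def interIn (X H : Submodule K V) : Submodule K X :=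
  H.comap X.subtype

theorem isCoatom_interIn {X H : Submodule K V} (hH : IsCoatom H) (h : ¬ X ≤ H) :
    IsCoatom (interIn X H) := by
  rcases Submodule.isCoatom_comap_or_eq_top X.subtype hH with h1 | h1
  · exact h1
  · exact absurd (Submodule.comap_subtype_eq_top.mp h1) h

/-- The restriction `A^X` of `A` to `X`: the arrangement in the vector space `X` that consists of
the `X ∩ H`, where `H` runs over the members of `A` that do not contain `X`. -/
def restriction (A : HyperplaneArrangement K V) (X : Submodule K V) :
    HyperplaneArrangement K X where
  hyperplanes := interIn X '' (A.hyperplanes \ A.localization X)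
  finite := (A.finite.subset Set.sdiff_subset).image _
  isCoatom := by
    rintro _ ⟨H, ⟨hH, hX⟩, rfl⟩
    exact isCoatom_interIn (A.isCoatom H hH) fun h => hX ⟨hH, h⟩

/-- The deletion `A' = A \ {H₀}`. -/
def deletion (A : HyperplaneArrangement K V) (H₀ : Submodule K V) :
    HyperplaneArrangement K V where
  hyperplanes := A.hyperplanes \ {H₀}
  finite := A.finite.subset Set.sdiff_subset
  isCoatom := fun H hH => A.isCoatom H hH.1

/-- The product `A₁ × A₂` in `V₁ ⊕ V₂`: the hyperplanes `H₁ ⊕ V₂` and `V₁ ⊕ H₂`. -/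
def prod {V₁ : Type u} {V₂ : Type v} [AddCommGroup V₁] [Module K V₁] [AddCommGroup V₂]
    [Module K V₂] (A₁ : HyperplaneArrangement K V₁) (A₂ : HyperplaneArrangement K V₂) :
    HyperplaneArrangement K (V₁ × V₂) where
  hyperplanes :=
    (fun H₁ : Submodule K V₁ => H₁.prod (⊤ : Submodule K V₂)) '' A₁.hyperplanes ∪
      (fun H₂ : Submodule K V₂ => (⊤ : Submodule K V₁).prod H₂) '' A₂.hyperplanes
  finite := (A₁.finite.image _).union (A₂.finite.image _)
  isCoatom := by
    rintro _ (⟨H, hH, rfl⟩ | ⟨H, hH, rfl⟩)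
    · have e : H.prod (⊤ : Submodule K V₂) = H.comap (LinearMap.fst K V₁ V₂) := by
        ext; simp
      refine (Submodule.isCoatom_comap_iff (f := LinearMap.fst K V₁ V₂)
        LinearMap.fst_surjective).mpr (A₁.isCoatom H hH) |> fun h => ?_
      simpa only [e] using h
    · have e : (⊤ : Submodule K V₁).prod H = H.comap (LinearMap.snd K V₁ V₂) := by
        ext; simp
      refine (Submodule.isCoatom_comap_iff (f := LinearMap.snd K V₁ V₂)
        LinearMap.snd_surjective).mpr (A₂.isCoatom H hH) |> fun h => ?_
      simpa only [e] using h

/-- A family `P` of sets of hyperplanes is independent: every choice of one hyperplane from each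
block meets in a subspace whose codimension is the number of blocks. -/
def Independent (P : Set (Set (Submodule K V))) : Prop :=
  ∀ c : Set (Submodule K V) → Submodule K V, (∀ B ∈ P, c B ∈ B) →
    Module.finrank K (V ⧸ ⨅ B ∈ P, c B) = P.ncard

/-- `P` is a nice partition (a factorization) of `A`. -/
structure IsFactorization (A : HyperplaneArrangement K V) (P : Set (Set (Submodule K V))) :
    Prop where
  isPartitionOf : IsPartitionOf P A.hyperplanes
  independent : Independent P
  exists_singleton : ∀ X ∈ A.lattice, X ≠ ⊤ →
    ∃ C ∈ inducedPartition P (A.localization X), ∃ H, C = {H}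

/-- `A` is factored (nice). -/
def IsFactored (A : HyperplaneArrangement K V) : Prop :=
  ∃ P, A.IsFactorization P

/-- `A` is hereditarily factored. -/
def IsHereditarilyFactored (A : HyperplaneArrangement K V) : Prop :=
  ∀ X ∈ A.lattice, (A.restriction X).IsFactored

end Basic

/-- `IsInductiveFactorization A P`: the pair `(A, P)` belongs to the class of inductively factored
arrangements, the smallest class of pairs of an arrangement and a partition of it that contains
`(∅, ∅)` in every vector space and is closed under addition of a hyperplane `H₀`. In `step`, `B₀`
is the block of `P` containing `H₀`, and the restriction map `H ↦ H ∩ H₀` from `A \ B₀` to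
`A'' = A^{H₀}` is bijective; the partition induced on `A''` has the images of the blocks other
than `B₀` as its blocks. -/
inductive IsInductiveFactorization {K : Type w} [Field K] :
    ∀ {V : Type u} [AddCommGroup V] [Module K V],
      HyperplaneArrangement K V → Set (Set (Submodule K V)) → Prop
  | empty (V : Type u) [AddCommGroup V] [Module K V] :
      IsInductiveFactorization (HyperplaneArrangement.empty K V) ∅
  | step {V : Type u} [AddCommGroup V] [Module K V] (A : HyperplaneArrangement K V)
      (P : Set (Set (Submodule K V))) (hP : IsPartitionOf P A.hyperplanes)
      (B₀ : Set (Submodule K V)) (hB₀ : B₀ ∈ P) (H₀ : Submodule K V) (hH₀ : H₀ ∈ B₀)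
      (bijective : Set.BijOn (interIn H₀) (A.hyperplanes \ B₀) (A.restriction H₀).hyperplanes)
      (deletion : IsInductiveFactorization (A.deletion H₀)
        (inducedPartition P (A.deletion H₀).hyperplanes))
      (restriction : IsInductiveFactorization (A.restriction H₀)
        ((fun B => interIn H₀ '' B) '' (P \ {B₀}))) :
      IsInductiveFactorization A P

section Inductive

variable {K : Type w} [Field K] {V : Type u} [AddCommGroup V] [Module K V]

/-- `A` is inductively factored. -/
def IsInductivelyFactored (A : HyperplaneArrangement K V) : Prop :=
  ∃ P, IsInductiveFactorization A P

/-- `A` is hereditarily inductively factored. -/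
def IsHereditarilyInductivelyFactored (A : HyperplaneArrangement K V) : Prop :=
  ∀ X ∈ A.lattice, (A.restriction X).IsInductivelyFactored

end Inductive

section Exponents

variable {K : Type w} [Field K] {V : Type u} [AddCommGroup V] [Module K V]

/-- The coordinate ring `S = S(V*)` of `V`, the symmetric algebra of the dual space. -/
abbrev CoordRing (K : Type w) (V : Type u) [Field K] [AddCommGroup V] [Module K V] :
    Type (max u w) :=
  SymmetricAlgebra K (Module.Dual K V)

/-- The homogeneous component `S_d` of `S(V*)`: the span of all products of `d` linear forms. -/
def homogeneousPart (K : Type w) (V : Type u) [Field K] [AddCommGroup V] [Module K V] (d : ℕ) :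
    Submodule K (CoordRing K V) :=
  LinearMap.range (SymmetricAlgebra.ι K (Module.Dual K V)) ^ d

/-- The `S`-module `D(A)` of `A`-derivations: the `K`-derivations `θ` of `S` such that `θ(α)` is
divisible by `α` for each linear form `α` defining a hyperplane of `A`. -/
def derivationModule (A : HyperplaneArrangement K V) :
    Submodule (CoordRing K V) (Derivation K (CoordRing K V) (CoordRing K V)) where
  carrier := {θ | ∀ H ∈ A.hyperplanes, ∀ α : Module.Dual K V, LinearMap.ker α = H →
    SymmetricAlgebra.ι K (Module.Dual K V) α ∣ θ (SymmetricAlgebra.ι K (Module.Dual K V) α)}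
  add_mem' := by
    intro θ η hθ hη H hH α hα
    simpa using dvd_add (hθ H hH α hα) (hη H hH α hα)
  zero_mem' := by
    intro H hH α hα
    simp
  smul_mem' := by
    intro f θ hθ H hH α hα
    simpa using Dvd.dvd.mul_left (hθ H hH α hα) f

/-- `θ` is homogeneous of polynomial degree `d`: it maps linear forms to `S_d`. -/
def IsHomogeneousDerivation (θ : Derivation K (CoordRing K V) (CoordRing K V)) (d : ℕ) : Prop :=
  ∀ α : Module.Dual K V, θ (SymmetricAlgebra.ι K (Module.Dual K V) α) ∈ homogeneousPart K V d

/-- `D(A)` has an `S`-basis of homogeneous derivations, the multiset of whose polynomial degrees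
is `e`. -/
def HasHomogeneousBasis (A : HyperplaneArrangement K V) (e : Multiset ℕ) : Prop :=
  ∃ (n : ℕ) (b : Module.Basis (Fin n) (CoordRing K V) A.derivationModule) (d : Fin n → ℕ),
    (∀ i, IsHomogeneousDerivation (b i : Derivation K (CoordRing K V) (CoordRing K V)) (d i)) ∧
      e = Multiset.map d Finset.univ.val

/-- `A` is free and `exp A = e`: the module `D(A)` is free with a homogeneous basis whose
polynomial degrees form the multiset `e`, and every homogeneous basis of it yields the same
multiset. -/
def IsFreeWithExponents (A : HyperplaneArrangement K V) (e : Multiset ℕ) : Prop :=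
  A.HasHomogeneousBasis e ∧ ∀ e' : Multiset ℕ, A.HasHomogeneousBasis e' → e' = e

end Exponents

end HyperplaneArrangement

universe v'

/-! Two constructions carry the combinatorial claims. For a surjection `f : V → W`, `descent` is the
localization of `A` at `ker f`, viewed in `W`. For `f₁`, `f₂` jointly surjective on `V`, `glue` is
the union of the two pulled-back arrangements. The product is a glued arrangement, and its factors
are its localizations at the kernels of the projections. Working with `glue` rather than `prod`
makes the class stable under restriction: the restriction to a lattice element is again glued from
restrictions of the factors, although the space is no longer literally a product.

Factorizations and inductive factorizations pass to localizations (`IsFactored.descent`,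
`IsInductiveFactorization.descent`) and to glued arrangements (`IsFactored.glue`,
`IsInductiveFactorization.glue`). Applied to all restrictions, this gives the two hereditary
equivalences.

For the exponents, an inductively factored arrangement is shown to be free, with exponents the block
sizes and as many zeros as the dimension exceeds the number of blocks
(`IsInductiveFactorization.hasHomogeneousBasis`). The induction rests on an addition theorem
(`HasHomogeneousBasis.addition`): a basis of `D(A')` becomes a basis of `D(A)` by multiplying one
element by the linear form `α₀` of `H₀` and correcting the others. Its divisibility input is Terao's
polynomial `B`, the product of the restrictions to `H₀` of the other forms in the block of `H₀`; it
divides `θ(α₀)` on `H₀` for each `θ ∈ D(A')` (`exists_product_dvd`). Block sizes and dimensions add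
under gluing, hence so do exponents. Their uniqueness follows by counting basis elements of degree
at most `m` (`card_filter_le`). -/

theorem IsPartitionOf.subset {α : Type u} {P : Set (Set α)} {s B : Set α} (h : IsPartitionOf P s)
    (hB : B ∈ P) : B ⊆ s := h.sUnion_eq ▸ Set.subset_sUnion_of_mem hB

theorem IsPartitionOf.nonempty {α : Type u} {P : Set (Set α)} {s B : Set α} (h : IsPartitionOf P s)
    (hB : B ∈ P) : B.Nonempty :=
  Set.nonempty_iff_ne_empty.2 fun e => h.empty_notMem (e ▸ hB)

theorem IsPartitionOf.eq_of_mem {α : Type u} {P : Set (Set α)} {s B C : Set α} {a : α}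
    (h : IsPartitionOf P s) (hB : B ∈ P) (hC : C ∈ P) (haB : a ∈ B) (haC : a ∈ C) : B = C :=
  h.pairwiseDisjoint.elim_set hB hC a haB haC

namespace HyperplaneArrangement

variable {K : Type w} [Field K]

theorem eq_of_hyperplanes_eq {V : Type u} [AddCommGroup V] [Module K V]
    {A B : HyperplaneArrangement K V} (h : A.hyperplanes = B.hyperplanes) : A = B := by
  cases A; cases B; cases h; rfl

theorem inducedPartition_eq_self {α : Type u} {P : Set (Set α)} {s t : Set α}
    (h : IsPartitionOf P s) (hst : s ⊆ t) : inducedPartition P t = P := by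
  have key : ∀ B ∈ P, B ∩ t = B := fun B hB =>
    Set.inter_eq_left.2 ((IsPartitionOf.subset h hB).trans hst)
  ext C
  constructor
  · rintro ⟨-, B, hB, rfl⟩
    rwa [key B hB]
  · intro hC
    exact ⟨IsPartitionOf.nonempty h hC, C, hC, (key C hC).symm⟩

/-! ### Localization along a surjection, and inductive factorizations of localizations. -/

section Descent

variable {V : Type u} [AddCommGroup V] [Module K V] {W : Type v} [AddCommGroup W] [Module K W]

/-- The arrangement in `W` of those hyperplanes whose preimages under the surjection `f : V → W`
belong to `A`. -/
def descent (A : HyperplaneArrangement K V) (f : V →ₗ[K] W) (hf : Function.Surjective f) :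
    HyperplaneArrangement K W where
  hyperplanes := Submodule.comap f ⁻¹' A.hyperplanes
  finite := A.finite.preimage (Submodule.comap_injective_of_surjective hf).injOn
  isCoatom := fun _ hH => (Submodule.isCoatom_comap_iff hf).1 (A.isCoatom _ hH)

/-- The non-empty preimages of the blocks of `P` under `g`. -/
def preimagePartition {α : Type u} {β : Type v} (g : β → α) (P : Set (Set α)) : Set (Set β) :=
  {C | C.Nonempty ∧ ∃ B ∈ P, C = g ⁻¹' B}

theorem isPartitionOf_preimage {α : Type u} {β : Type v} (g : β → α) {P : Set (Set α)}
    {s : Set α} (h : IsPartitionOf P s) : IsPartitionOf (preimagePartition g P) (g ⁻¹' s) where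
  empty_notMem := fun h => by simpa using h.1
  pairwiseDisjoint := by
    rintro _ ⟨-, B, hB, rfl⟩ _ ⟨-, C, hC, rfl⟩ hne
    refine Disjoint.preimage g (h.pairwiseDisjoint hB hC ?_)
    rintro rfl
    exact hne rfl
  sUnion_eq := by
    ext b
    constructor
    · rintro ⟨_, ⟨-, B, hB, rfl⟩, hb⟩
      exact IsPartitionOf.subset h hB hb
    · intro hb
      obtain ⟨B, hB, hbB⟩ : g b ∈ ⋃₀ P := h.sUnion_eq ▸ hb
      exact ⟨g ⁻¹' B, ⟨⟨b, hbB⟩, B, hB, rfl⟩, hbB⟩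

theorem preimagePartition_induced {α : Type u} {β : Type v} (g : β → α) (P : Set (Set α))
    (s : Set α) :
    preimagePartition g (inducedPartition P s) = inducedPartition (preimagePartition g P) (g ⁻¹' s) := by
  ext C
  constructor
  · rintro ⟨hC, _, ⟨-, B, hB, rfl⟩, rfl⟩
    exact ⟨hC, g ⁻¹' B, ⟨hC.mono fun _ hx => hx.1, B, hB, rfl⟩, rfl⟩
  · rintro ⟨hC, _, ⟨-, B, hB, rfl⟩, rfl⟩
    obtain ⟨b, hb⟩ := hC
    exact ⟨⟨b, hb⟩, B ∩ s, ⟨⟨g b, hb⟩, B, hB, rfl⟩, rfl⟩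

theorem mem_restriction {A : HyperplaneArrangement K V} {X : Submodule K V} {L : Submodule K X} :
    L ∈ (A.restriction X).hyperplanes ↔ ∃ H ∈ A.hyperplanes, ¬ X ≤ H ∧ interIn X H = L := by
  constructor
  · rintro ⟨H, ⟨h1, h2⟩, rfl⟩
    exact ⟨H, h1, fun h => h2 ⟨h1, h⟩, rfl⟩
  · rintro ⟨H, h1, h2, rfl⟩
    exact ⟨H, ⟨h1, fun h => h2 h.2⟩, rfl⟩

/-- The map `f⁻¹(X) → X` induced by `f`. -/
def comapRestrict (f : V →ₗ[K] W) (X : Submodule K W) : ↥(X.comap f) →ₗ[K] X :=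
  f.restrict fun _ hx => hx

theorem comapRestrict_surjective {f : V →ₗ[K] W} (hf : Function.Surjective f)
    (X : Submodule K W) : Function.Surjective (comapRestrict f X) := by
  rintro ⟨x, hx⟩
  obtain ⟨v, rfl⟩ := hf x
  exact ⟨⟨v, hx⟩, rfl⟩

theorem comap_comapRestrict_interIn (f : V →ₗ[K] W) (X H : Submodule K W) :
    (interIn X H).comap (comapRestrict f X) = interIn (X.comap f) (H.comap f) := rfl

/-- The trace of `H` on `f⁻¹(X)` is a preimage, so it contains `ker f`. Hence `H` contains `ker f`
and is itself a preimage. -/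
theorem exists_comap_eq {f : V →ₗ[K] W} (hf : Function.Surjective f) {X : Submodule K W}
    {H : Submodule K V} {L : Submodule K X}
    (h : interIn (X.comap f) H = L.comap (comapRestrict f X)) :
    ∃ H' : Submodule K W, H'.comap f = H ∧ interIn X H' = L := by
  have hk : LinearMap.ker f ≤ H := by
    intro x hx
    have hx0 : f x = 0 := hx
    have hxX : x ∈ X.comap f := by simp [hx0]
    have : (⟨x, hxX⟩ : X.comap f) ∈ L.comap (comapRestrict f X) := by
      have e : comapRestrict f X ⟨x, hxX⟩ = 0 := Subtype.ext hx0
      simp [e]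
    rw [← h] at this
    exact this
  refine ⟨H.map f, Submodule.comap_map_eq_self hk, ?_⟩
  apply Submodule.comap_injective_of_surjective (comapRestrict_surjective hf X)
  rw [comap_comapRestrict_interIn, Submodule.comap_map_eq_self hk, h]

theorem restriction_descent (A : HyperplaneArrangement K V) {f : V →ₗ[K] W}
    (hf : Function.Surjective f) (X : Submodule K W) :
    (A.descent f hf).restriction X =
      (A.restriction (X.comap f)).descent (comapRestrict f X) (comapRestrict_surjective hf X) := by
  apply eq_of_hyperplanes_eq
  ext L
  change _ ↔ L.comap _ ∈ (A.restriction (X.comap f)).hyperplanes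
  rw [mem_restriction, mem_restriction]
  constructor
  · rintro ⟨H, h1, h2, rfl⟩
    exact ⟨H.comap f, h1, fun h => h2 ((Submodule.comap_le_comap_iff_of_surjective hf).1 h), rfl⟩
  · rintro ⟨H, h1, h2, h3⟩
    obtain ⟨H, rfl, rfl⟩ := exists_comap_eq hf h3
    exact ⟨H, h1, fun h => h2 (Submodule.comap_mono h), rfl⟩

/-- Localizing and restricting commute for partitions as well. The block of `H₀` can be removed
before or after taking preimages because distinct blocks with non-empty preimages have distinct
preimages. -/
theorem restriction_preimagePartition {A : HyperplaneArrangement K V}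
    {P : Set (Set (Submodule K V))} {B₀ : Set (Submodule K V)} {f : V →ₗ[K] W}
    (hf : Function.Surjective f) {H₀ : Submodule K W} (hP : IsPartitionOf P A.hyperplanes)
    (hB₀ : B₀ ∈ P) :
    (fun B => interIn H₀ '' B) ''
        (preimagePartition (Submodule.comap f) P \ {Submodule.comap f ⁻¹' B₀}) =
      preimagePartition (Submodule.comap (comapRestrict f H₀))
        ((fun B => interIn (H₀.comap f) '' B) '' (P \ {B₀})) := by
  have key : ∀ B : Set (Submodule K V), interIn H₀ '' (Submodule.comap f ⁻¹' B) =
      Submodule.comap (comapRestrict f H₀) ⁻¹' (interIn (H₀.comap f) '' B) := by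
    intro B
    ext L
    constructor
    · rintro ⟨H, hH, rfl⟩
      exact ⟨H.comap f, hH, rfl⟩
    · rintro ⟨H, hH, e⟩
      obtain ⟨H, rfl, rfl⟩ := exists_comap_eq hf e
      exact ⟨H, hH, rfl⟩
  ext C
  constructor
  · rintro ⟨_, ⟨⟨hne, B, hB, rfl⟩, hBB⟩, rfl⟩
    exact ⟨hne.image _, _, ⟨B, ⟨hB, fun h => hBB (by rw [Set.mem_singleton_iff.1 h]; rfl)⟩, rfl⟩,
      key B⟩
  · rintro ⟨hne, _, ⟨B, ⟨hB, hBB⟩, rfl⟩, rfl⟩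
    rw [← key B, Set.image_nonempty] at hne
    refine ⟨_, ⟨⟨hne, B, hB, rfl⟩, fun h => hBB ?_⟩, key B⟩
    obtain ⟨L, hL⟩ := hne
    have hL' : L ∈ Submodule.comap f ⁻¹' B₀ := Set.mem_singleton_iff.1 h ▸ hL
    exact IsPartitionOf.eq_of_mem hP hB hB₀ hL hL'

/-- The inductive construction of `A` is replayed in `W`, skipping every added hyperplane that does
not contain `ker f`. Quantifying over all `W` and `f` inside the induction is needed because the
restriction step replaces `f` by `comapRestrict f H₀`. -/
theorem IsInductiveFactorization.descent {A : HyperplaneArrangement K V}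
    {P : Set (Set (Submodule K V))} (h : IsInductiveFactorization A P) :
    ∀ {W : Type v} [AddCommGroup W] [Module K W] (f : V →ₗ[K] W) (hf : Function.Surjective f),
      IsInductiveFactorization (A.descent f hf) (preimagePartition (Submodule.comap f) P) := by
  induction h with
  | empty V =>
    intro W _ _ f hf
    convert IsInductiveFactorization.empty W using 1
    · exact eq_of_hyperplanes_eq rfl
    ext C
    exact ⟨fun ⟨_, _, h, _⟩ => h.elim, fun h => h.elim⟩
  | step A P hP B₀ hB₀ H₀ hH₀ bij hdel hres ihd ihr =>
    intro W _ _ f hf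
    have hpart : IsPartitionOf (preimagePartition (Submodule.comap f) P)
      (A.descent f hf).hyperplanes := isPartitionOf_preimage _ hP
    by_cases hex : ∃ L : Submodule K W, L.comap f = H₀
    · obtain ⟨H₀, rfl⟩ := hex
      have hd : (A.descent f hf).deletion H₀ = (A.deletion (H₀.comap f)).descent f hf := by
        apply eq_of_hyperplanes_eq
        ext H
        simp [HyperplaneArrangement.descent, HyperplaneArrangement.deletion,
          (Submodule.comap_injective_of_surjective hf).eq_iff]
      refine IsInductiveFactorization.step _ _ hpart (Submodule.comap f ⁻¹' B₀)
        ⟨⟨H₀, hH₀⟩, B₀, hB₀, rfl⟩ H₀ hH₀ ⟨?_, ?_, ?_⟩ ?_ ?_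
      · intro H hH
        rw [restriction_descent]
        exact bij.mapsTo hH
      · intro H hH H' hH' e
        apply Submodule.comap_injective_of_surjective hf
        apply bij.injOn hH hH'
        rw [← comap_comapRestrict_interIn, ← comap_comapRestrict_interIn, e]
      · intro L hL
        rw [restriction_descent] at hL
        obtain ⟨H, hH, e⟩ := bij.surjOn hL
        obtain ⟨H, rfl, rfl⟩ := exists_comap_eq hf e
        exact ⟨H, hH, rfl⟩
      · rw [hd]
        convert ihd f hf using 1
        exact (preimagePartition_induced _ _ (A.deletion (H₀.comap f)).hyperplanes).symm
      · rw [restriction_descent, restriction_preimagePartition hf hP hB₀]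
        exact ihr _ _
    -- Here `H₀` is no preimage, so it is invisible in `W` and the deletion already has the same
    -- localization and the same induced partition.
    · have hd : (A.deletion H₀).descent f hf = A.descent f hf := by
        apply eq_of_hyperplanes_eq
        ext H
        simp only [HyperplaneArrangement.descent, HyperplaneArrangement.deletion,
          Set.mem_preimage, Set.mem_sdiff, Set.mem_singleton_iff, and_iff_left_iff_imp]
        exact fun _ e => hex ⟨H, e⟩
      have := ihd f hf
      rw [preimagePartition_induced, hd] at this
      rwa [inducedPartition_eq_self hpart] at this
      rw [← hd]
      exact subset_rfl

end Descent

/-! ### Products as arrangements glued along jointly surjective maps. -/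

section Glue

variable {V : Type u} [AddCommGroup V] [Module K V]
  {V₁ : Type v} [AddCommGroup V₁] [Module K V₁] {V₂ : Type v'} [AddCommGroup V₂] [Module K V₂]

theorem surjective_fst_of_prod {f₁ : V →ₗ[K] V₁} {f₂ : V →ₗ[K] V₂}
    (hf : Function.Surjective (f₁.prod f₂)) : Function.Surjective f₁ := fun x => by
  obtain ⟨v, hv⟩ := hf (x, 0)
  exact ⟨v, congrArg Prod.fst hv⟩

theorem surjective_snd_of_prod {f₁ : V →ₗ[K] V₁} {f₂ : V →ₗ[K] V₂}
    (hf : Function.Surjective (f₁.prod f₂)) : Function.Surjective f₂ := fun x => by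
  obtain ⟨v, hv⟩ := hf (0, x)
  exact ⟨v, congrArg Prod.snd hv⟩

/-- The union of the preimages in `V` of the arrangements `A₁` and `A₂`. -/
def glue (A₁ : HyperplaneArrangement K V₁) (A₂ : HyperplaneArrangement K V₂)
    (f₁ : V →ₗ[K] V₁) (f₂ : V →ₗ[K] V₂) (hf : Function.Surjective (f₁.prod f₂)) :
    HyperplaneArrangement K V where
  hyperplanes := Submodule.comap f₁ '' A₁.hyperplanes ∪ Submodule.comap f₂ '' A₂.hyperplanes
  finite := (A₁.finite.image _).union (A₂.finite.image _)
  isCoatom := by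
    rintro _ (⟨H, hH, rfl⟩ | ⟨H, hH, rfl⟩)
    · exact (Submodule.isCoatom_comap_iff (surjective_fst_of_prod hf)).2 (A₁.isCoatom H hH)
    · exact (Submodule.isCoatom_comap_iff (surjective_snd_of_prod hf)).2 (A₂.isCoatom H hH)

/-- The union of the partitions `P₁` and `P₂`, pulled back to `V`. -/
def gluePartition (P₁ : Set (Set (Submodule K V₁))) (P₂ : Set (Set (Submodule K V₂)))
    (f₁ : V →ₗ[K] V₁) (f₂ : V →ₗ[K] V₂) : Set (Set (Submodule K V)) :=
  Set.image (Submodule.comap f₁) '' P₁ ∪ Set.image (Submodule.comap f₂) '' P₂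

theorem exists_of_surjective_prod {f₁ : V →ₗ[K] V₁} {f₂ : V →ₗ[K] V₂}
    (hf : Function.Surjective (f₁.prod f₂)) (x₁ : V₁) (x₂ : V₂) : ∃ v, f₁ v = x₁ ∧ f₂ v = x₂ := by
  obtain ⟨v, hv⟩ := hf (x₁, x₂)
  exact ⟨v, congrArg Prod.fst hv, congrArg Prod.snd hv⟩

/-- By joint surjectivity the second coordinate is arbitrary on the kernel of `f₁`. This separates
the two families of hyperplanes in a glued arrangement. -/
theorem not_inf_comap_le {f₁ : V →ₗ[K] V₁} {f₂ : V →ₗ[K] V₂}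
    (hf : Function.Surjective (f₁.prod f₂)) (X : Submodule K V₁) {H : Submodule K V₂}
    (hH : H ≠ ⊤) : ¬ X.comap f₁ ≤ H.comap f₂ := by
  intro h
  apply hH
  rw [eq_top_iff]
  intro x _
  obtain ⟨v, h1, rfl⟩ := exists_of_surjective_prod hf 0 x
  exact h (by simp [h1])

theorem surjective_prod_swap {f₁ : V →ₗ[K] V₁} {f₂ : V →ₗ[K] V₂}
    (hf : Function.Surjective (f₁.prod f₂)) : Function.Surjective (f₂.prod f₁) := fun ⟨x, y⟩ => by
  obtain ⟨v, h1, h2⟩ := exists_of_surjective_prod hf y x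
  exact ⟨v, Prod.ext h2 h1⟩

theorem glue_comm (A₁ : HyperplaneArrangement K V₁) (A₂ : HyperplaneArrangement K V₂)
    (f₁ : V →ₗ[K] V₁) (f₂ : V →ₗ[K] V₂) (hf : Function.Surjective (f₁.prod f₂))
    (hf' : Function.Surjective (f₂.prod f₁)) : A₁.glue A₂ f₁ f₂ hf = A₂.glue A₁ f₂ f₁ hf' :=
  eq_of_hyperplanes_eq (Set.union_comm _ _)

theorem comap_ne_comap {f₁ : V →ₗ[K] V₁} {f₂ : V →ₗ[K] V₂}
    (hf : Function.Surjective (f₁.prod f₂)) {H₁ : Submodule K V₁} {H₂ : Submodule K V₂}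
    (h₂ : H₂ ≠ ⊤) : H₁.comap f₁ ≠ H₂.comap f₂ := fun h =>
  not_inf_comap_le hf H₁ h₂ h.le

theorem isPartitionOf_glue {A₁ : HyperplaneArrangement K V₁} {A₂ : HyperplaneArrangement K V₂}
    {P₁ : Set (Set (Submodule K V₁))} {P₂ : Set (Set (Submodule K V₂))}
    {f₁ : V →ₗ[K] V₁} {f₂ : V →ₗ[K] V₂} (hf : Function.Surjective (f₁.prod f₂))
    (h₁ : IsPartitionOf P₁ A₁.hyperplanes) (h₂ : IsPartitionOf P₂ A₂.hyperplanes) :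
    IsPartitionOf (gluePartition P₁ P₂ f₁ f₂) (A₁.glue A₂ f₁ f₂ hf).hyperplanes where
  empty_notMem := by
    rintro (⟨B, hB, e⟩ | ⟨B, hB, e⟩) <;> rw [Set.image_eq_empty] at e <;> subst e
    · exact h₁.empty_notMem hB
    · exact h₂.empty_notMem hB
  pairwiseDisjoint := by
    have i₁ := Submodule.comap_injective_of_surjective (surjective_fst_of_prod hf)
    have i₂ := Submodule.comap_injective_of_surjective (surjective_snd_of_prod hf)
    have cross : ∀ B ∈ P₁, ∀ C ∈ P₂, Disjoint (Submodule.comap f₁ '' B)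
        (Submodule.comap f₂ '' C) := by
      intro B _ C hC
      rw [Set.disjoint_left]
      rintro _ ⟨H, _, rfl⟩ ⟨H', hH', e⟩
      exact comap_ne_comap hf (A₂.isCoatom _ (h₂.subset hC hH')).1 e.symm
    rintro _ (⟨B, hB, rfl⟩ | ⟨B, hB, rfl⟩) _ (⟨C, hC, rfl⟩ | ⟨C, hC, rfl⟩) hne
    · exact (Set.disjoint_image_iff i₁).2 (h₁.pairwiseDisjoint hB hC fun e => hne (e ▸ rfl))
    · exact cross B hB C hC
    · exact (cross C hC B hB).symm
    · exact (Set.disjoint_image_iff i₂).2 (h₂.pairwiseDisjoint hB hC fun e => hne (e ▸ rfl))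
  sUnion_eq := by
    rw [gluePartition, Set.sUnion_union, ← Set.image_sUnion, ← Set.image_sUnion, h₁.sUnion_eq,
      h₂.sUnion_eq]
    rfl

theorem glue_deletion (A₁ : HyperplaneArrangement K V₁) (A₂ : HyperplaneArrangement K V₂)
    {f₁ : V →ₗ[K] V₁} {f₂ : V →ₗ[K] V₂} (hf : Function.Surjective (f₁.prod f₂))
    (H₀ : Submodule K V₁) :
    (A₁.glue A₂ f₁ f₂ hf).deletion (H₀.comap f₁) = (A₁.deletion H₀).glue A₂ f₁ f₂ hf := by
  have i₁ := Submodule.comap_injective_of_surjective (surjective_fst_of_prod hf)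
  apply eq_of_hyperplanes_eq
  ext H
  constructor
  · rintro ⟨⟨H, hH, rfl⟩ | ⟨H, hH, rfl⟩, h⟩
    · exact Or.inl ⟨H, ⟨hH, fun e => h (congrArg (Submodule.comap f₁) e)⟩, rfl⟩
    · exact Or.inr ⟨H, hH, rfl⟩
  · rintro (⟨H, ⟨hH, hn⟩, rfl⟩ | ⟨H, hH, rfl⟩)
    · exact ⟨Or.inl ⟨H, hH, rfl⟩, fun e => hn (i₁ e)⟩
    · exact ⟨Or.inr ⟨H, hH, rfl⟩, fun e => comap_ne_comap hf (A₂.isCoatom _ hH).1 e.symm⟩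

theorem inducedPartition_gluePartition {A₁ : HyperplaneArrangement K V₁}
    {A₂ : HyperplaneArrangement K V₂} {P₁ : Set (Set (Submodule K V₁))}
    {P₂ : Set (Set (Submodule K V₂))} {f₁ : V →ₗ[K] V₁} {f₂ : V →ₗ[K] V₂}
    (hf : Function.Surjective (f₁.prod f₂)) (h₂ : IsPartitionOf P₂ A₂.hyperplanes) :
    inducedPartition (gluePartition P₁ P₂ f₁ f₂) (A₁.glue A₂ f₁ f₂ hf).hyperplanes =
      gluePartition (inducedPartition P₁ A₁.hyperplanes) P₂ f₁ f₂ := by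
  have i₁ := Submodule.comap_injective_of_surjective (surjective_fst_of_prod hf)
  have k₁ : ∀ B : Set (Submodule K V₁), Submodule.comap f₁ '' B ∩ (A₁.glue A₂ f₁ f₂ hf).hyperplanes
      = Submodule.comap f₁ '' (B ∩ A₁.hyperplanes) := by
    intro B
    ext H
    constructor
    · rintro ⟨⟨H, hH, rfl⟩, ⟨H', hH', e⟩ | ⟨H', hH', e⟩⟩
      · exact ⟨H, ⟨hH, i₁ e ▸ hH'⟩, rfl⟩
      · exact (comap_ne_comap hf (A₂.isCoatom _ hH').1 e.symm).elim
    · rintro ⟨H, ⟨hH, hA⟩, rfl⟩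
      exact ⟨⟨H, hH, rfl⟩, Or.inl ⟨H, hA, rfl⟩⟩
  have k₂ : ∀ B ∈ P₂, Submodule.comap f₂ '' B ∩ (A₁.glue A₂ f₁ f₂ hf).hyperplanes
      = Submodule.comap f₂ '' B := fun B hB =>
    Set.inter_eq_left.2 ((Set.image_mono (h₂.subset hB)).trans Set.subset_union_right)
  ext C
  constructor
  · rintro ⟨hne, _, ⟨B, hB, rfl⟩ | ⟨B, hB, rfl⟩, rfl⟩
    · rw [k₁, Set.image_nonempty] at hne
      rw [k₁]
      exact Or.inl ⟨_, ⟨hne, B, hB, rfl⟩, rfl⟩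
    · rw [k₂ B hB]
      exact Or.inr ⟨B, hB, rfl⟩
  · rintro (⟨_, ⟨hne, B, hB, rfl⟩, rfl⟩ | ⟨B, hB, rfl⟩)
    · exact ⟨hne.image _, _, Or.inl ⟨B, hB, rfl⟩, (k₁ B).symm⟩
    · exact ⟨(h₂.nonempty hB).image _, _, Or.inr ⟨B, hB, rfl⟩, (k₂ B hB).symm⟩

/-- The two maps along which the restriction of a glued arrangement to `f₁⁻¹(X)` is glued. -/
theorem surjective_comapRestrict_prod {f₁ : V →ₗ[K] V₁} {f₂ : V →ₗ[K] V₂}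
    (hf : Function.Surjective (f₁.prod f₂)) (X : Submodule K V₁) :
    Function.Surjective ((comapRestrict f₁ X).prod (f₂ ∘ₗ (X.comap f₁).subtype)) := by
  rintro ⟨⟨x, hx⟩, y⟩
  obtain ⟨v, rfl, rfl⟩ := exists_of_surjective_prod hf x y
  exact ⟨⟨v, hx⟩, rfl⟩

theorem glue_restriction (A₁ : HyperplaneArrangement K V₁) (A₂ : HyperplaneArrangement K V₂)
    {f₁ : V →ₗ[K] V₁} {f₂ : V →ₗ[K] V₂} (hf : Function.Surjective (f₁.prod f₂))
    (X : Submodule K V₁) :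
    (A₁.glue A₂ f₁ f₂ hf).restriction (X.comap f₁) =
      (A₁.restriction X).glue A₂ (comapRestrict f₁ X) (f₂ ∘ₗ (X.comap f₁).subtype)
        (surjective_comapRestrict_prod hf X) := by
  have s₁ := surjective_fst_of_prod hf
  apply eq_of_hyperplanes_eq
  ext L
  rw [mem_restriction]
  constructor
  · rintro ⟨_, ⟨H, hH, rfl⟩ | ⟨H, hH, rfl⟩, hX, rfl⟩
    · exact Or.inl ⟨interIn X H, mem_restriction.2 ⟨H, hH, fun h => hX (Submodule.comap_mono h), rfl⟩,
        rfl⟩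
    · exact Or.inr ⟨H, hH, rfl⟩
  · rintro (⟨L, hL, rfl⟩ | ⟨H, hH, rfl⟩)
    · obtain ⟨H, hH, hX, rfl⟩ := mem_restriction.1 hL
      exact ⟨H.comap f₁, Or.inl ⟨H, hH, rfl⟩,
        fun h => hX ((Submodule.comap_le_comap_iff_of_surjective s₁).1 h), rfl⟩
    · exact ⟨H.comap f₂, Or.inr ⟨H, hH, rfl⟩, not_inf_comap_le hf X (A₂.isCoatom _ hH).1, rfl⟩

theorem isInductiveFactorization_isPartitionOf {A : HyperplaneArrangement K V}
    {P : Set (Set (Submodule K V))} (h : IsInductiveFactorization A P) :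
    IsPartitionOf P A.hyperplanes := by
  cases h with
  | empty => exact ⟨fun h => h, by simp, by simp [HyperplaneArrangement.empty]⟩
  | step _ _ hP => exact hP

end Glue

/-- Induction on the first factor with the second fixed: each step that adds `H₀` to `A₁` adds its
preimage to the glued arrangement, and both deletion and restriction act on the first factor alone.
The base case, a mere pullback of `A₂`, is the hypothesis `hc`, phrased as gluing with an empty
arrangement so that `glue` can supply it by this same lemma with the factors exchanged. -/
theorem IsInductiveFactorization.glue_of_comap {V₁ : Type v} [AddCommGroup V₁] [Module K V₁]
    {A₁ : HyperplaneArrangement K V₁} {P₁ : Set (Set (Submodule K V₁))}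
    (h₁ : IsInductiveFactorization A₁ P₁) {V₂ : Type v'} [AddCommGroup V₂] [Module K V₂]
    {A₂ : HyperplaneArrangement K V₂} {P₂ : Set (Set (Submodule K V₂))}
    (h₂ : IsPartitionOf P₂ A₂.hyperplanes)
    (hc : ∀ {V : Type u} [AddCommGroup V] [Module K V] (f₁ : V →ₗ[K] PUnit.{1}) (f₂ : V →ₗ[K] V₂)
      (hf : Function.Surjective (f₁.prod f₂)),
      IsInductiveFactorization ((HyperplaneArrangement.empty K PUnit).glue A₂ f₁ f₂ hf) (gluePartition ∅ P₂ f₁ f₂)) :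
    ∀ {V : Type u} [AddCommGroup V] [Module K V] (f₁ : V →ₗ[K] V₁) (f₂ : V →ₗ[K] V₂)
      (hf : Function.Surjective (f₁.prod f₂)),
      IsInductiveFactorization (A₁.glue A₂ f₁ f₂ hf) (gluePartition P₁ P₂ f₁ f₂) := by
  induction h₁ with
  | empty V₁ =>
    intro V _ _ f₁ f₂ hf
    have hs : Function.Surjective ((0 : V →ₗ[K] PUnit.{1}).prod f₂) := fun ⟨_, x⟩ => by
      obtain ⟨v, rfl⟩ := surjective_snd_of_prod hf x
      exact ⟨v, rfl⟩
    convert hc 0 f₂ hs using 1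
    · apply eq_of_hyperplanes_eq
      simp [glue, HyperplaneArrangement.empty]
    · simp [gluePartition]
  | step A₁ P₁ hP B₀ hB₀ H₀ hH₀ bij hdel hres ihd ihr =>
    intro V _ _ f₁ f₂ hf
    have i₁ := Submodule.comap_injective_of_surjective (surjective_fst_of_prod hf)
    have i₂ := Submodule.comap_injective_of_surjective (surjective_snd_of_prod hf)
    have hg := surjective_comapRestrict_prod hf H₀
    have hpart := isPartitionOf_glue hf hP h₂
    have hB : Submodule.comap f₁ '' B₀ ∈ gluePartition P₁ P₂ f₁ f₂ := Or.inl ⟨B₀, hB₀, rfl⟩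
    refine IsInductiveFactorization.step _ _ hpart _ hB (H₀.comap f₁) ⟨H₀, hH₀, rfl⟩ ⟨?_, ?_, ?_⟩
      ?_ ?_
    · rw [glue_restriction]
      rintro _ ⟨⟨H, hH, rfl⟩ | ⟨H, hH, rfl⟩, hn⟩
      · exact Or.inl ⟨_, bij.mapsTo ⟨hH, fun h => hn ⟨H, h, rfl⟩⟩, rfl⟩
      · exact Or.inr ⟨H, hH, rfl⟩
    · rintro _ ⟨⟨H, hH, rfl⟩ | ⟨H, hH, rfl⟩, hn⟩ _ ⟨⟨H', hH', rfl⟩ | ⟨H', hH', rfl⟩, hn'⟩ e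
      · refine congrArg _ (bij.injOn ⟨hH, fun h => hn ⟨H, h, rfl⟩⟩ ⟨hH', fun h => hn' ⟨H', h, rfl⟩⟩ ?_)
        exact Submodule.comap_injective_of_surjective (surjective_fst_of_prod hg) e
      · exact (comap_ne_comap hg (H₁ := interIn H₀ H) (A₂.isCoatom _ hH').1 e).elim
      · exact (comap_ne_comap hg (H₁ := interIn H₀ H') (A₂.isCoatom _ hH).1 e.symm).elim
      · exact congrArg _ (Submodule.comap_injective_of_surjective (surjective_snd_of_prod hg) e)
    · rw [glue_restriction]
      rintro _ (⟨L, hL, rfl⟩ | ⟨H, hH, rfl⟩)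
      · obtain ⟨H, hH, rfl⟩ := bij.surjOn hL
        exact ⟨H.comap f₁, ⟨Or.inl ⟨H, hH.1, rfl⟩, fun ⟨H', hH', e⟩ => hH.2 (i₁ e ▸ hH')⟩, rfl⟩
      · exact ⟨H.comap f₂, ⟨Or.inr ⟨H, hH, rfl⟩,
          fun ⟨H', hH', e⟩ => comap_ne_comap hf (A₂.isCoatom _ hH).1 e⟩, rfl⟩
    · rw [glue_deletion, inducedPartition_gluePartition hf h₂]
      exact ihd f₁ f₂ hf
    · rw [glue_restriction]
      convert ihr _ _ hg using 1
      -- Removing the block of `H₀` must leave every block that comes from `P₂`.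
      have inj : ∀ B ∈ P₂, Submodule.comap f₂ '' B ≠ Submodule.comap f₁ '' B₀ := by
        intro B hB e
        obtain ⟨H, hH⟩ := h₂.nonempty hB
        obtain ⟨H', -, e'⟩ : H.comap f₂ ∈ Submodule.comap f₁ '' B₀ := e ▸ ⟨H, hH, rfl⟩
        exact comap_ne_comap hf (A₂.isCoatom _ (h₂.subset hB hH)).1 e'
      ext C
      constructor
      · rintro ⟨_, ⟨⟨B, hB, rfl⟩ | ⟨B, hB, rfl⟩, hn⟩, rfl⟩
        · refine Or.inl ⟨_, ⟨B, ⟨hB, fun h => hn (congrArg _ h)⟩, rfl⟩, ?_⟩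
          simp only [Set.image_image]
          rfl
        · refine Or.inr ⟨B, hB, ?_⟩
          simp only [Set.image_image]
          rfl
      · rintro (⟨_, ⟨B, ⟨hB, hn⟩, rfl⟩, rfl⟩ | ⟨B, hB, rfl⟩)
        · refine ⟨_, ⟨Or.inl ⟨B, hB, rfl⟩, fun h => hn (Set.image_injective.2 i₁ h)⟩, ?_⟩
          simp only [Set.image_image]
          rfl
        · refine ⟨_, ⟨Or.inr ⟨B, hB, rfl⟩, inj B hB⟩, ?_⟩
          simp only [Set.image_image]
          rfl

theorem IsInductiveFactorization.glue {V₁ : Type v} [AddCommGroup V₁] [Module K V₁]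
    {A₁ : HyperplaneArrangement K V₁} {P₁ : Set (Set (Submodule K V₁))}
    (h₁ : IsInductiveFactorization A₁ P₁) {V₂ : Type v'} [AddCommGroup V₂] [Module K V₂]
    {A₂ : HyperplaneArrangement K V₂} {P₂ : Set (Set (Submodule K V₂))}
    (h₂ : IsInductiveFactorization A₂ P₂)
    {V : Type u} [AddCommGroup V] [Module K V] (f₁ : V →ₗ[K] V₁) (f₂ : V →ₗ[K] V₂)
    (hf : Function.Surjective (f₁.prod f₂)) :
    IsInductiveFactorization (A₁.glue A₂ f₁ f₂ hf) (gluePartition P₁ P₂ f₁ f₂) := by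
  refine h₁.glue_of_comap (isInductiveFactorization_isPartitionOf h₂) ?_ f₁ f₂ hf
  intro V _ _ f₁ f₂ hf
  have hf' := surjective_prod_swap hf
  have h₀ : IsInductiveFactorization (HyperplaneArrangement.empty K PUnit.{1}) ∅ := .empty _
  -- The pullback of `A₂` is obtained by a second induction, now on `A₂`, whose own base case is the
  -- empty arrangement.
  rw [glue_comm _ _ f₁ f₂ hf hf', gluePartition, Set.union_comm]
  refine h₂.glue_of_comap (isInductiveFactorization_isPartitionOf h₀) ?_ f₂ f₁ hf'
  intro V _ _ f₁ f₂ hf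
  convert IsInductiveFactorization.empty V using 1
  · apply eq_of_hyperplanes_eq
    simp [HyperplaneArrangement.glue, HyperplaneArrangement.empty]
  · simp [gluePartition]

end HyperplaneArrangement

theorem IsPartitionOf.finite {α : Type u} {P : Set (Set α)} {s : Set α} (h : IsPartitionOf P s)
    (hs : s.Finite) : P.Finite :=
  hs.finite_subsets.subset fun _ hB => h.subset hB

namespace HyperplaneArrangement

variable {K : Type w} [Field K]

/-! ### Codimension counts. -/

section Codimension

variable {V : Type u} [AddCommGroup V] [Module K V]
  {V₁ : Type v} [AddCommGroup V₁] [Module K V₁] {V₂ : Type v'} [AddCommGroup V₂] [Module K V₂]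

theorem finrank_quotient_eq_one {H : Submodule K V} (hH : IsCoatom H) :
    Module.finrank K (V ⧸ H) = 1 :=
  isSimpleModule_iff_finrank_eq_one.1 (isSimpleModule_iff_isCoatom.2 hH)

theorem finrank_quotient_comap {f : V →ₗ[K] V₁} (hf : Function.Surjective f)
    (X : Submodule K V₁) : Module.finrank K (V ⧸ X.comap f) = Module.finrank K (V₁ ⧸ X) := by
  have hk : X.comap f = LinearMap.ker (X.mkQ ∘ₗ f) := by
    rw [LinearMap.ker_comp, Submodule.ker_mkQ]
  rw [hk]
  exact (LinearMap.quotKerEquivOfSurjective (X.mkQ ∘ₗ f) (X.mkQ_surjective.comp hf)).finrank_eq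

theorem finrank_quotient_inf_comap [FiniteDimensional K V₁] [FiniteDimensional K V₂]
    {f₁ : V →ₗ[K] V₁} {f₂ : V →ₗ[K] V₂}
    (hf : Function.Surjective (f₁.prod f₂)) (X₁ : Submodule K V₁) (X₂ : Submodule K V₂) :
    Module.finrank K (V ⧸ X₁.comap f₁ ⊓ X₂.comap f₂) =
      Module.finrank K (V₁ ⧸ X₁) + Module.finrank K (V₂ ⧸ X₂) := by
  have hk : X₁.comap f₁ ⊓ X₂.comap f₂ =
      LinearMap.ker ((X₁.mkQ.prodMap X₂.mkQ) ∘ₗ f₁.prod f₂) := by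
    ext v
    simp
  rw [hk, (LinearMap.quotKerEquivOfSurjective _ ?_).finrank_eq, Module.finrank_prod]
  exact (Prod.map_surjective.2 ⟨X₁.mkQ_surjective, X₂.mkQ_surjective⟩).comp hf

theorem finrank_quotient_inf_le [FiniteDimensional K V] (X Y : Submodule K V) :
    Module.finrank K (V ⧸ X ⊓ Y) ≤ Module.finrank K (V ⧸ X) + Module.finrank K (V ⧸ Y) := by
  have h := Submodule.finrank_sup_add_finrank_inf_eq X Y
  have h1 := X.finrank_quotient_add_finrank
  have h2 := Y.finrank_quotient_add_finrank
  have h3 := (X ⊓ Y).finrank_quotient_add_finrank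
  have h4 := (X ⊔ Y).finrank_le
  omega

theorem finrank_quotient_biInf_le [FiniteDimensional K V] {ι : Type*} {S : Set ι} (hS : S.Finite)
    (c : ι → Submodule K V) (hc : ∀ i ∈ S, IsCoatom (c i)) :
    Module.finrank K (V ⧸ ⨅ i ∈ S, c i) ≤ S.ncard := by
  induction S, hS using Set.Finite.induction_on with
  | empty =>
    rw [iInf_emptyset, Set.ncard_empty]
    exact Module.finrank_zero_of_subsingleton.le
  | @insert a S ha hS ih =>
    rw [iInf_insert, Set.ncard_insert_of_notMem ha hS]
    have h1 := finrank_quotient_inf_le (c a) (⨅ i ∈ S, c i)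
    have h2 := finrank_quotient_eq_one (hc a (Set.mem_insert _ _))
    have h3 := ih fun i hi => hc i (Set.mem_insert_of_mem _ hi)
    omega

end Codimension

/-! ### Factorizations of localizations and glued arrangements, and the hereditary statements. -/

section Factored

variable {V : Type u} [AddCommGroup V] [Module K V]

/-- A subfamily of independent blocks is independent: the codimension of the full intersection is
the number of all blocks, codimension is subadditive, and each of the two parts contributes at most
its number of blocks, so both bounds are attained. -/
theorem independent_preimagePartition [FiniteDimensional K V] {W : Type v} [AddCommGroup W]
    [Module K W] {A : HyperplaneArrangement K V} {P : Set (Set (Submodule K V))}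
    (hP : IsPartitionOf P A.hyperplanes) (hI : Independent P) {f : V →ₗ[K] W}
    (hf : Function.Surjective f) : Independent (preimagePartition (Submodule.comap f) P) := by
  classical
  intro c hc
  set S : Set (Set (Submodule K V)) := {B ∈ P | (Submodule.comap f ⁻¹' B).Nonempty} with hS
  have hSP : S ⊆ P := fun _ h => h.1
  have hfin := hP.finite A.finite
  have hcm : ∀ B ∈ S, (c (Submodule.comap f ⁻¹' B)).comap f ∈ B := fun B hB =>
    hc _ ⟨hB.2, B, hB.1, rfl⟩
  -- The given choice is used on the blocks that meet the localization; on the others any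
  -- representative serves to complete it to a choice for all of `P`.
  let c' : Set (Submodule K V) → Submodule K V := fun B =>
    if (Submodule.comap f ⁻¹' B).Nonempty then (c (Submodule.comap f ⁻¹' B)).comap f
    else Classical.epsilon fun H => H ∈ B
  have hc' : ∀ B ∈ P, c' B ∈ B := by
    intro B hB
    by_cases h : (Submodule.comap f ⁻¹' B).Nonempty
    · simp only [c', if_pos h]
      exact hcm B ⟨hB, h⟩
    · simp only [c', if_neg h]
      exact Classical.epsilon_spec (hP.nonempty hB)
  have hco : ∀ B ∈ P, IsCoatom (c' B) := fun B hB => A.isCoatom _ (hP.subset hB (hc' B hB))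
  have himg : preimagePartition (Submodule.comap f) P = (fun B => Submodule.comap f ⁻¹' B) '' S := by
    ext C
    constructor
    · rintro ⟨hne, B, hB, rfl⟩
      exact ⟨B, ⟨hB, hne⟩, rfl⟩
    · rintro ⟨B, hB, rfl⟩
      exact ⟨hB.2, B, hB.1, rfl⟩
  have hinj : Set.InjOn (fun B => Submodule.comap f ⁻¹' B) S := by
    intro B hB C hC e
    obtain ⟨H, hH⟩ := hB.2
    have hH' : H ∈ Submodule.comap f ⁻¹' C := by
      rw [← show Submodule.comap f ⁻¹' B = Submodule.comap f ⁻¹' C from e]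
      exact hH
    exact hP.eq_of_mem hB.1 hC.1 hH hH'
  have hle : Module.finrank K (V ⧸ ⨅ B ∈ S, c' B) ≤ S.ncard :=
    finrank_quotient_biInf_le (hfin.subset hSP) c' fun B hB => hco B (hSP hB)
  have hle' : Module.finrank K (V ⧸ ⨅ B ∈ P \ S, c' B) ≤ (P \ S).ncard :=
    finrank_quotient_biInf_le (hfin.subset Set.sdiff_subset) c' fun B hB => hco B hB.1
  have hun : (⨅ B ∈ P, c' B) = (⨅ B ∈ S, c' B) ⊓ ⨅ B ∈ P \ S, c' B := by
    rw [← iInf_union, Set.union_sdiff_cancel hSP]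
  have htot := hI c' hc'
  rw [hun] at htot
  have hsub := finrank_quotient_inf_le (⨅ B ∈ S, c' B) (⨅ B ∈ P \ S, c' B)
  have hcard := Set.ncard_sdiff_add_ncard_of_subset hSP hfin
  have hcom : (⨅ B ∈ S, c' B) = (⨅ C ∈ preimagePartition (Submodule.comap f) P, c C).comap f := by
    rw [himg, iInf_image, Submodule.comap_iInf]
    simp only [Submodule.comap_iInf]
    refine iInf_congr fun B => iInf_congr fun hB => ?_
    simp only [c', if_pos hB.2]
  rw [← finrank_quotient_comap hf, ← hcom, himg, Set.InjOn.ncard_image hinj]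
  omega

theorem comap_mem_lattice_of_descent {W : Type v} [AddCommGroup W] [Module K W]
    {A : HyperplaneArrangement K V} {f : V →ₗ[K] W} {hf : Function.Surjective f}
    {X : Submodule K W} (hX : X ∈ (A.descent f hf).lattice) : X.comap f ∈ A.lattice := by
  obtain ⟨T, hT, rfl⟩ := hX
  refine ⟨Submodule.comap f '' T, ?_, ?_⟩
  · rintro _ ⟨H, hH, rfl⟩
    exact hT hH
  · rw [sInf_image, sInf_eq_iInf]
    simp only [Submodule.comap_iInf]

theorem IsFactored.descent [FiniteDimensional K V] {W : Type v} [AddCommGroup W]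
    [Module K W] {A : HyperplaneArrangement K V} (h : A.IsFactored) (f : V →ₗ[K] W)
    (hf : Function.Surjective f) : (A.descent f hf).IsFactored := by
  obtain ⟨P, hP, hI, hs⟩ := h
  refine ⟨_, isPartitionOf_preimage _ hP, independent_preimagePartition hP hI hf, ?_⟩
  intro X hX hne
  have hne' : X.comap f ≠ ⊤ := fun e => hne (by
    apply Submodule.comap_injective_of_surjective hf
    rw [e, Submodule.comap_top])
  obtain ⟨C, ⟨-, B, hB, rfl⟩, H, hH⟩ := hs _ (comap_mem_lattice_of_descent hX) hne'
  have hHm : H ∈ B ∩ A.localization (X.comap f) := hH ▸ rfl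
  -- The singleton survives in `W`: its member contains `f⁻¹(X)`, hence `ker f`, so it comes from a
  -- hyperplane of `W`.
  have hk : LinearMap.ker f ≤ H := le_trans (LinearMap.ker_le_comap f) hHm.2.2
  have e : (H.map f).comap f = H := Submodule.comap_map_eq_self hk
  have hX' : X ≤ H.map f := by
    rw [← Submodule.comap_le_comap_iff_of_surjective hf, e]
    exact hHm.2.2
  refine ⟨{H.map f}, ⟨Set.singleton_nonempty _, Submodule.comap f ⁻¹' B,
    ⟨⟨H.map f, by rw [Set.mem_preimage, e]; exact hHm.1⟩, B, hB, rfl⟩, ?_⟩, _, rfl⟩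
  ext L
  constructor
  · rintro rfl
    refine ⟨by rw [Set.mem_preimage, e]; exact hHm.1, ?_, hX'⟩
    change _ ∈ A.hyperplanes
    rw [e]
    exact hHm.2.1
  · rintro ⟨h1, h2, h3⟩
    have : L.comap f ∈ B ∩ A.localization (X.comap f) := ⟨h1, h2, Submodule.comap_mono h3⟩
    rw [hH] at this
    apply Submodule.comap_injective_of_surjective hf
    rw [e]
    exact this

variable {V₁ : Type v} [AddCommGroup V₁] [Module K V₁] {V₂ : Type v'} [AddCommGroup V₂] [Module K V₂]

theorem inf_comap_le_comap_iff {f₁ : V →ₗ[K] V₁} {f₂ : V →ₗ[K] V₂}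
    (hf : Function.Surjective (f₁.prod f₂)) {X₁ H : Submodule K V₁} {X₂ : Submodule K V₂} :
    X₁.comap f₁ ⊓ X₂.comap f₂ ≤ H.comap f₁ ↔ X₁ ≤ H := by
  refine ⟨fun h x hx => ?_, fun h => inf_le_left.trans (Submodule.comap_mono h)⟩
  obtain ⟨v, rfl, h2⟩ := exists_of_surjective_prod hf x 0
  exact h ⟨hx, by simp [h2]⟩

theorem exists_of_mem_lattice_glue {A₁ : HyperplaneArrangement K V₁}
    {A₂ : HyperplaneArrangement K V₂} {f₁ : V →ₗ[K] V₁} {f₂ : V →ₗ[K] V₂}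
    {hf : Function.Surjective (f₁.prod f₂)} {X : Submodule K V}
    (hX : X ∈ (A₁.glue A₂ f₁ f₂ hf).lattice) :
    ∃ X₁ ∈ A₁.lattice, ∃ X₂ ∈ A₂.lattice, X = X₁.comap f₁ ⊓ X₂.comap f₂ := by
  obtain ⟨T, hT, rfl⟩ := hX
  refine ⟨_, ⟨{H ∈ A₁.hyperplanes | H.comap f₁ ∈ T}, fun _ h => h.1, rfl⟩,
    _, ⟨{H ∈ A₂.hyperplanes | H.comap f₂ ∈ T}, fun _ h => h.1, rfl⟩, ?_⟩
  apply le_antisymm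
  · simp only [sInf_eq_iInf, Submodule.comap_iInf]
    exact le_inf (le_iInf₂ fun H hH => iInf₂_le _ hH.2) (le_iInf₂ fun H hH => iInf₂_le _ hH.2)
  · refine le_sInf fun H hH => ?_
    rcases hT hH with ⟨H, hA, rfl⟩ | ⟨H, hA, rfl⟩
    · exact inf_le_left.trans (Submodule.comap_mono (sInf_le ⟨hA, hH⟩))
    · exact inf_le_right.trans (Submodule.comap_mono (sInf_le ⟨hA, hH⟩))

theorem comap_mem_lattice_glue {A₁ : HyperplaneArrangement K V₁}
    {A₂ : HyperplaneArrangement K V₂} {f₁ : V →ₗ[K] V₁} {f₂ : V →ₗ[K] V₂}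
    (hf : Function.Surjective (f₁.prod f₂)) {X : Submodule K V₁}
    (hX : X ∈ A₁.lattice) : X.comap f₁ ∈ (A₁.glue A₂ f₁ f₂ hf).lattice := by
  obtain ⟨T, hT, rfl⟩ := hX
  refine ⟨Submodule.comap f₁ '' T, ?_, ?_⟩
  · rintro _ ⟨H, hH, rfl⟩
    exact Or.inl ⟨H, hT hH, rfl⟩
  · rw [sInf_image, sInf_eq_iInf]
    simp only [Submodule.comap_iInf]

/-- No hyperplane coming from `A₂` contains `ker f₁`. Properties inherited by localizations
therefore pass from a product to its factors. -/
theorem descent_glue (A₁ : HyperplaneArrangement K V₁) (A₂ : HyperplaneArrangement K V₂)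
    {f₁ : V →ₗ[K] V₁} {f₂ : V →ₗ[K] V₂} (hf : Function.Surjective (f₁.prod f₂)) :
    (A₁.glue A₂ f₁ f₂ hf).descent f₁ (surjective_fst_of_prod hf) = A₁ := by
  apply eq_of_hyperplanes_eq
  ext H
  constructor
  · rintro (⟨H', hH, e⟩ | ⟨H', hH, e⟩)
    · exact Submodule.comap_injective_of_surjective (surjective_fst_of_prod hf) e ▸ hH
    · exact (comap_ne_comap hf (A₂.isCoatom _ hH).1 e.symm).elim
  · exact fun hH => Or.inl ⟨H, hH, rfl⟩

theorem disjoint_gluePartition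
    {A₂ : HyperplaneArrangement K V₂} {P₁ : Set (Set (Submodule K V₁))}
    {P₂ : Set (Set (Submodule K V₂))}
    (h₂ : IsPartitionOf P₂ A₂.hyperplanes) {f₁ : V →ₗ[K] V₁} {f₂ : V →ₗ[K] V₂}
    (hf : Function.Surjective (f₁.prod f₂)) :
    Disjoint (Set.image (Submodule.comap f₁) '' P₁) (Set.image (Submodule.comap f₂) '' P₂) := by
  rw [Set.disjoint_left]
  rintro _ ⟨B, hB, rfl⟩ ⟨C, hC, e⟩
  obtain ⟨H, hH⟩ := h₂.nonempty hC
  obtain ⟨H', -, e'⟩ : H.comap f₂ ∈ Submodule.comap f₁ '' B := e ▸ ⟨H, hH, rfl⟩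
  exact comap_ne_comap hf (A₂.isCoatom _ (h₂.subset hC hH)).1 e'

theorem independent_glue [FiniteDimensional K V₁] [FiniteDimensional K V₂]
    {A₁ : HyperplaneArrangement K V₁} {A₂ : HyperplaneArrangement K V₂}
    {P₁ : Set (Set (Submodule K V₁))}
    {P₂ : Set (Set (Submodule K V₂))} (h₁ : IsPartitionOf P₁ A₁.hyperplanes)
    (h₂ : IsPartitionOf P₂ A₂.hyperplanes) (hI₁ : Independent P₁) (hI₂ : Independent P₂)
    {f₁ : V →ₗ[K] V₁} {f₂ : V →ₗ[K] V₂}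
    (hf : Function.Surjective (f₁.prod f₂)) : Independent (gluePartition P₁ P₂ f₁ f₂) := by
  have i₁ := Submodule.comap_injective_of_surjective (surjective_fst_of_prod hf)
  have i₂ := Submodule.comap_injective_of_surjective (surjective_snd_of_prod hf)
  intro c hc
  have e₁ : ∀ B : Set (Submodule K V₁), ∃ H, B ∈ P₁ → H ∈ B ∧
      H.comap f₁ = c (Submodule.comap f₁ '' B) := by
    intro B
    by_cases hB : B ∈ P₁
    · obtain ⟨H, hH, e⟩ := hc _ (Or.inl ⟨B, hB, rfl⟩)
      exact ⟨H, fun _ => ⟨hH, e⟩⟩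
    · exact ⟨⊤, fun h => (hB h).elim⟩
  have e₂ : ∀ B : Set (Submodule K V₂), ∃ H, B ∈ P₂ → H ∈ B ∧
      H.comap f₂ = c (Submodule.comap f₂ '' B) := by
    intro B
    by_cases hB : B ∈ P₂
    · obtain ⟨H, hH, e⟩ := hc _ (Or.inr ⟨B, hB, rfl⟩)
      exact ⟨H, fun _ => ⟨hH, e⟩⟩
    · exact ⟨⊤, fun h => (hB h).elim⟩
  choose c₁ hc₁ using e₁
  choose c₂ hc₂ using e₂
  have key : (⨅ B ∈ gluePartition P₁ P₂ f₁ f₂, c B) =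
      (⨅ B ∈ P₁, c₁ B).comap f₁ ⊓ (⨅ B ∈ P₂, c₂ B).comap f₂ := by
    simp only [gluePartition, iInf_union, iInf_image, Submodule.comap_iInf]
    congr 1
    · exact iInf_congr fun B => iInf_congr fun hB => (hc₁ B hB).2.symm
    · exact iInf_congr fun B => iInf_congr fun hB => (hc₂ B hB).2.symm
  rw [key, finrank_quotient_inf_comap hf, hI₁ c₁ fun B hB => (hc₁ B hB).1,
    hI₂ c₂ fun B hB => (hc₂ B hB).1, gluePartition, Set.ncard_union_eq (disjoint_gluePartition h₂ hf)
      ((h₁.finite A₁.finite).image _) ((h₂.finite A₂.finite).image _),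
    Set.ncard_image_of_injective _ (Set.image_injective.2 i₁),
    Set.ncard_image_of_injective _ (Set.image_injective.2 i₂)]

/-- Whether a hyperplane pulled back from `V₁` contains the intersection depends only on `X₁`, so
the blocks from `P₁` meet the localization exactly as they do in `A₁`. -/
theorem exists_singleton_glue {A₁ : HyperplaneArrangement K V₁} {A₂ : HyperplaneArrangement K V₂}
    {P₁ : Set (Set (Submodule K V₁))} {P₂ : Set (Set (Submodule K V₂))}
    {f₁ : V →ₗ[K] V₁} {f₂ : V →ₗ[K] V₂} (hf : Function.Surjective (f₁.prod f₂))
    {X₁ : Submodule K V₁} (X₂ : Submodule K V₂)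
    (h : ∃ C ∈ inducedPartition P₁ (A₁.localization X₁), ∃ H, C = {H}) :
    ∃ C ∈ inducedPartition (gluePartition P₁ P₂ f₁ f₂)
      ((A₁.glue A₂ f₁ f₂ hf).localization (X₁.comap f₁ ⊓ X₂.comap f₂)), ∃ H, C = {H} := by
  obtain ⟨_, ⟨-, B, hB, rfl⟩, H, hH⟩ := h
  refine ⟨{H.comap f₁}, ⟨Set.singleton_nonempty _, _, Or.inl ⟨B, hB, rfl⟩, ?_⟩, _, rfl⟩
  rw [← Set.image_singleton, ← hH]
  ext L
  constructor
  · rintro ⟨L, ⟨h1, h2, h3⟩, rfl⟩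
    exact ⟨⟨L, h1, rfl⟩, Or.inl ⟨L, h2, rfl⟩, (inf_comap_le_comap_iff hf).2 h3⟩
  · rintro ⟨⟨L, h1, rfl⟩, ⟨L', h2, e⟩ | ⟨L', h2, e⟩, h3⟩
    · refine ⟨L, ⟨h1, ?_, (inf_comap_le_comap_iff hf).1 h3⟩, rfl⟩
      exact Submodule.comap_injective_of_surjective (surjective_fst_of_prod hf) e ▸ h2
    · exact (comap_ne_comap hf (A₂.isCoatom _ h2).1 e.symm).elim

theorem IsFactored.glue [FiniteDimensional K V₁] [FiniteDimensional K V₂]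
    {A₁ : HyperplaneArrangement K V₁} {A₂ : HyperplaneArrangement K V₂}
    (h₁ : A₁.IsFactored) (h₂ : A₂.IsFactored) {f₁ : V →ₗ[K] V₁} {f₂ : V →ₗ[K] V₂}
    (hf : Function.Surjective (f₁.prod f₂)) : (A₁.glue A₂ f₁ f₂ hf).IsFactored := by
  obtain ⟨P₁, hP₁, hI₁, hs₁⟩ := h₁
  obtain ⟨P₂, hP₂, hI₂, hs₂⟩ := h₂
  refine ⟨_, isPartitionOf_glue hf hP₁ hP₂, independent_glue hP₁ hP₂ hI₁ hI₂ hf, ?_⟩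
  intro X hX hne
  obtain ⟨X₁, h1, X₂, h2, rfl⟩ := exists_of_mem_lattice_glue hX
  -- A proper `X` is proper in at least one coordinate, and that factor supplies the singleton.
  by_cases ht : X₁ = ⊤
  · have ht2 : X₂ ≠ ⊤ := by
      rintro rfl
      exact hne (by rw [ht]; simp)
    rw [glue_comm _ _ _ _ hf (surjective_prod_swap hf), inf_comm, gluePartition, Set.union_comm]
    exact exists_singleton_glue _ _ (hs₂ _ h2 ht2)
  · exact exists_singleton_glue _ _ (hs₁ _ h1 ht)

/-- The joint surjectivity needed to restrict a glued arrangement to a member of its lattice. -/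
theorem surjective_restrict_prod {f₁ : V →ₗ[K] V₁} {f₂ : V →ₗ[K] V₂}
    (hf : Function.Surjective (f₁.prod f₂)) (X₁ : Submodule K V₁) (X₂ : Submodule K V₂) :
    Function.Surjective
      ((f₁.restrict (p := X₁.comap f₁ ⊓ X₂.comap f₂) (q := X₁) fun _ h => h.1).prod
        (f₂.restrict (p := X₁.comap f₁ ⊓ X₂.comap f₂) (q := X₂) fun _ h => h.2)) := by
  rintro ⟨⟨x, hx⟩, y, hy⟩
  obtain ⟨v, rfl, rfl⟩ := exists_of_surjective_prod hf x y
  exact ⟨⟨v, hx, hy⟩, rfl⟩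

theorem glue_restriction_inf (A₁ : HyperplaneArrangement K V₁) (A₂ : HyperplaneArrangement K V₂)
    {f₁ : V →ₗ[K] V₁} {f₂ : V →ₗ[K] V₂} (hf : Function.Surjective (f₁.prod f₂))
    (X₁ : Submodule K V₁) (X₂ : Submodule K V₂) :
    (A₁.glue A₂ f₁ f₂ hf).restriction (X₁.comap f₁ ⊓ X₂.comap f₂) =
      (A₁.restriction X₁).glue (A₂.restriction X₂) _ _ (surjective_restrict_prod hf X₁ X₂) := by
  have hf' := surjective_prod_swap hf
  apply eq_of_hyperplanes_eq
  ext L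
  rw [mem_restriction]
  constructor
  · rintro ⟨_, ⟨H, hH, rfl⟩ | ⟨H, hH, rfl⟩, hX, rfl⟩
    · exact Or.inl ⟨interIn X₁ H, mem_restriction.2
        ⟨H, hH, fun h => hX ((inf_comap_le_comap_iff hf).2 h), rfl⟩, rfl⟩
    · exact Or.inr ⟨interIn X₂ H, mem_restriction.2
        ⟨H, hH, fun h => hX (inf_comm (X₂.comap f₂) _ ▸ (inf_comap_le_comap_iff hf').2 h), rfl⟩, rfl⟩
  · rintro (⟨L, hL, rfl⟩ | ⟨L, hL, rfl⟩)
    · obtain ⟨H, hH, hX, rfl⟩ := mem_restriction.1 hL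
      exact ⟨H.comap f₁, Or.inl ⟨H, hH, rfl⟩, fun h => hX ((inf_comap_le_comap_iff hf).1 h), rfl⟩
    · obtain ⟨H, hH, hX, rfl⟩ := mem_restriction.1 hL
      refine ⟨H.comap f₂, Or.inr ⟨H, hH, rfl⟩, fun h => hX ?_, rfl⟩
      rw [inf_comm] at h
      exact (inf_comap_le_comap_iff hf').1 h

theorem prod_eq_glue (A₁ : HyperplaneArrangement K V₁) (A₂ : HyperplaneArrangement K V₂) :
    A₁.prod A₂ = A₁.glue A₂ (LinearMap.fst K V₁ V₂) (LinearMap.snd K V₁ V₂)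
      (fun x => ⟨x, rfl⟩) := by
  apply eq_of_hyperplanes_eq
  have h1 : ∀ H : Submodule K V₁, H.prod (⊤ : Submodule K V₂) = H.comap (LinearMap.fst K V₁ V₂) :=
    fun H => by ext; simp
  have h2 : ∀ H : Submodule K V₂, (⊤ : Submodule K V₁).prod H = H.comap (LinearMap.snd K V₁ V₂) :=
    fun H => by ext; simp
  simp only [prod, HyperplaneArrangement.glue, h1, h2]

theorem IsHereditarilyFactored.of_glue [FiniteDimensional K V] {A₁ : HyperplaneArrangement K V₁}
    {A₂ : HyperplaneArrangement K V₂} {f₁ : V →ₗ[K] V₁} {f₂ : V →ₗ[K] V₂}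
    {hf : Function.Surjective (f₁.prod f₂)} (h : (A₁.glue A₂ f₁ f₂ hf).IsHereditarilyFactored) :
    A₁.IsHereditarilyFactored := by
  intro X hX
  have := h _ (comap_mem_lattice_glue hf hX)
  rw [glue_restriction] at this
  rw [← descent_glue (A₁.restriction X) A₂ (surjective_comapRestrict_prod hf X)]
  exact this.descent _ _

theorem IsHereditarilyFactored.glue [FiniteDimensional K V₁] [FiniteDimensional K V₂]
    {A₁ : HyperplaneArrangement K V₁} {A₂ : HyperplaneArrangement K V₂}
    (h₁ : A₁.IsHereditarilyFactored) (h₂ : A₂.IsHereditarilyFactored)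
    {f₁ : V →ₗ[K] V₁} {f₂ : V →ₗ[K] V₂} (hf : Function.Surjective (f₁.prod f₂)) :
    (A₁.glue A₂ f₁ f₂ hf).IsHereditarilyFactored := by
  intro X hX
  obtain ⟨X₁, hX₁, X₂, hX₂, rfl⟩ := exists_of_mem_lattice_glue hX
  rw [glue_restriction_inf]
  exact (h₁ X₁ hX₁).glue (h₂ X₂ hX₂) _

theorem IsInductivelyFactored.of_glue {A₁ : HyperplaneArrangement K V₁}
    {A₂ : HyperplaneArrangement K V₂} {f₁ : V →ₗ[K] V₁} {f₂ : V →ₗ[K] V₂}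
    {hf : Function.Surjective (f₁.prod f₂)} (h : (A₁.glue A₂ f₁ f₂ hf).IsInductivelyFactored) :
    A₁.IsInductivelyFactored := by
  obtain ⟨P, hP⟩ := h
  rw [← descent_glue A₁ A₂ hf]
  exact ⟨_, hP.descent _ _⟩

theorem IsHereditarilyInductivelyFactored.of_glue {A₁ : HyperplaneArrangement K V₁}
    {A₂ : HyperplaneArrangement K V₂} {f₁ : V →ₗ[K] V₁} {f₂ : V →ₗ[K] V₂}
    {hf : Function.Surjective (f₁.prod f₂)}
    (h : (A₁.glue A₂ f₁ f₂ hf).IsHereditarilyInductivelyFactored) :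
    A₁.IsHereditarilyInductivelyFactored := by
  intro X hX
  have := h _ (comap_mem_lattice_glue hf hX)
  rw [glue_restriction] at this
  exact this.of_glue

theorem IsHereditarilyInductivelyFactored.glue {A₁ : HyperplaneArrangement K V₁}
    {A₂ : HyperplaneArrangement K V₂} (h₁ : A₁.IsHereditarilyInductivelyFactored)
    (h₂ : A₂.IsHereditarilyInductivelyFactored) {f₁ : V →ₗ[K] V₁} {f₂ : V →ₗ[K] V₂}
    (hf : Function.Surjective (f₁.prod f₂)) :
    (A₁.glue A₂ f₁ f₂ hf).IsHereditarilyInductivelyFactored := by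
  intro X hX
  obtain ⟨X₁, hX₁, X₂, hX₂, rfl⟩ := exists_of_mem_lattice_glue hX
  rw [glue_restriction_inf]
  obtain ⟨P₁, hP₁⟩ := h₁ X₁ hX₁
  obtain ⟨P₂, hP₂⟩ := h₂ X₂ hX₂
  exact ⟨_, hP₁.glue hP₂ _ _ _⟩

end Factored

end HyperplaneArrangement

/-! ### The symmetric algebra: grading, prime linear forms and derivations. -/

namespace SymmetricAlgebra

open Polynomial

variable {K : Type w} [Field K] {M : Type u} [AddCommGroup M] [Module K M]
  {N : Type v} [AddCommGroup N] [Module K N]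

/-- The algebra homomorphism `S(M) → S(M)[X]` that sends `m` to `m X`; its coefficients are the
homogeneous components. -/
noncomputable def toPolynomial (K : Type w) [Field K] (M : Type u) [AddCommGroup M] [Module K M] :
    SymmetricAlgebra K M →ₐ[K] (SymmetricAlgebra K M)[X] :=
  lift ((LinearMap.mulRight K (X : (SymmetricAlgebra K M)[X])) ∘ₗ
    (Polynomial.CAlgHom (R := K) (A := SymmetricAlgebra K M)).toLinearMap ∘ₗ ι K M)

theorem toPolynomial_ι (m : M) : toPolynomial K M (ι K M m) = C (ι K M m) * X := by
  simp [toPolynomial]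

theorem toPolynomial_of_mem {d : ℕ} {f : SymmetricAlgebra K M}
    (hf : f ∈ LinearMap.range (ι K M) ^ d) : toPolynomial K M f = C f * X ^ d := by
  induction hf using Submodule.pow_induction_on_left' with
  | algebraMap r => simp [AlgHom.commutes, Polynomial.algebraMap_apply]
  | add x y i hx hy h1 h2 => rw [map_add, h1, h2, C_add, add_mul]
  | mem_mul m hm i x hx h =>
    obtain ⟨m, rfl⟩ := hm
    rw [map_mul, h, toPolynomial_ι, C_mul, pow_succ]
    ring

/-- The homogeneous component of degree `d`. -/
noncomputable def component (d : ℕ) (f : SymmetricAlgebra K M) : SymmetricAlgebra K M :=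
  (toPolynomial K M f).coeff d

theorem component_sum {ι' : Type*} (s : Finset ι') (d : ℕ) (f : ι' → SymmetricAlgebra K M) :
    component d (∑ i ∈ s, f i) = ∑ i ∈ s, component d (f i) := by
  simp [component, map_sum]

theorem component_mul_of_mem {e : ℕ} {g : SymmetricAlgebra K M}
    (hg : g ∈ LinearMap.range (ι K M) ^ e) (h : SymmetricAlgebra K M) (d : ℕ) :
    component d (g * h) = if e ≤ d then g * component (d - e) h else 0 := by
  rw [component, map_mul, toPolynomial_of_mem hg, mul_assoc, coeff_C_mul, coeff_X_pow_mul']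
  split_ifs
  · rfl
  · simp

theorem component_of_mem {e : ℕ} {g : SymmetricAlgebra K M}
    (hg : g ∈ LinearMap.range (ι K M) ^ e) : component e g = g := by
  rw [component, toPolynomial_of_mem hg, coeff_C_mul, coeff_X_pow_self, mul_one]

theorem component_mem (d : ℕ) (f : SymmetricAlgebra K M) :
    component d f ∈ LinearMap.range (ι K M) ^ d := by
  induction f using SymmetricAlgebra.induction generalizing d with
  | algebraMap r =>
    rw [component, AlgHom.commutes, Polynomial.algebraMap_apply, coeff_C]
    split_ifs with h
    · rw [h, pow_zero]
      exact Submodule.algebraMap_mem r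
    · exact zero_mem _
  | ι m =>
    rw [component, toPolynomial_ι, coeff_C_mul, coeff_X]
    split_ifs with h
    · rw [← h, pow_one, mul_one]
      exact LinearMap.mem_range_self _ _
    · rw [mul_zero]
      exact zero_mem _
  | mul a b ha hb =>
    rw [component, map_mul, coeff_mul]
    refine sum_mem fun p hp => ?_
    rw [← Finset.HasAntidiagonal.mem_antidiagonal.1 hp, pow_add]
    exact Submodule.mul_mem_mul (ha _) (hb _)
  | add a b ha hb =>
    rw [component, map_add, coeff_add]
    exact add_mem (ha d) (hb d)

theorem mul_mem_range_pow {d e : ℕ} {f g : SymmetricAlgebra K M}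
    (hf : f ∈ LinearMap.range (ι K M) ^ d) (hg : g ∈ LinearMap.range (ι K M) ^ e) :
    f * g ∈ LinearMap.range (ι K M) ^ (d + e) := by
  rw [pow_add]
  exact Submodule.mul_mem_mul hf hg

theorem ι_mem_range_pow_one (m : M) : ι K M m ∈ LinearMap.range (ι K M) ^ 1 := by
  rw [pow_one]
  exact LinearMap.mem_range_self _ _

theorem prod_mem_range_pow {ι' : Type*} (s : Finset ι') (m : ι' → M) :
    ∏ i ∈ s, ι K M (m i) ∈ LinearMap.range (ι K M) ^ s.card := by
  classical
  induction s using Finset.induction_on with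
  | empty =>
    rw [Finset.prod_empty, Finset.card_empty, pow_zero]
    exact Submodule.one_le.1 le_rfl
  | insert a s ha ih =>
    rw [Finset.prod_insert ha, Finset.card_insert_of_notMem ha, add_comm]
    exact mul_mem_range_pow (ι_mem_range_pow_one _) ih

theorem ι_eq_zero_iff {m : M} : ι K M m = 0 ↔ m = 0 := by
  refine ⟨fun h => ?_, fun h => by rw [h, map_zero]⟩
  refine (Module.forall_dual_apply_eq_zero_iff K m).1 fun φ => ?_
  rw [← lift_ι_apply φ m, h, map_zero]

/-- The homomorphism of symmetric algebras induced by a linear map. -/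
noncomputable def mapLinear (u : M →ₗ[K] N) : SymmetricAlgebra K M →ₐ[K] SymmetricAlgebra K N :=
  lift (ι K N ∘ₗ u)

@[simp]
theorem mapLinear_ι (u : M →ₗ[K] N) (m : M) : mapLinear u (ι K M m) = ι K N (u m) := by
  simp [mapLinear]

theorem mapLinear_mem {u : M →ₗ[K] N} {d : ℕ} {f : SymmetricAlgebra K M}
    (hf : f ∈ LinearMap.range (ι K M) ^ d) :
    mapLinear u f ∈ LinearMap.range (ι K N) ^ d := by
  induction hf using Submodule.pow_induction_on_left' with
  | algebraMap r =>
    rw [AlgHom.commutes, pow_zero]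
    exact Submodule.algebraMap_mem r
  | add x y i hx hy h1 h2 =>
    rw [map_add]
    exact add_mem h1 h2
  | mem_mul m hm i x hx h =>
    obtain ⟨m, rfl⟩ := hm
    rw [map_mul, mapLinear_ι, Nat.succ_eq_add_one, add_comm]
    exact mul_mem_range_pow (ι_mem_range_pow_one _) h

theorem mapLinear_mapLinear_of_comp_eq_id {u : M →ₗ[K] N} {s : N →ₗ[K] M} (h : u ∘ₗ s = .id)
    (f : SymmetricAlgebra K N) : mapLinear u (mapLinear s f) = f := by
  have : (mapLinear u).comp (mapLinear s) = AlgHom.id K _ := by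
    ext m
    simpa using congrArg (ι K N) (LinearMap.congr_fun h m)
  exact DFunLike.congr_fun this f

/-- Modulo `m₀`, the composite `s ∘ u` is the identity on generators, hence on the whole algebra; an
element killed by `u` is therefore zero modulo `m₀`. -/
theorem mapLinear_eq_zero_iff {u : M →ₗ[K] N} {s : N →ₗ[K] M} (h : u ∘ₗ s = .id) {m₀ : M}
    (hm : LinearMap.ker u = K ∙ m₀) {f : SymmetricAlgebra K M} :
    mapLinear u f = 0 ↔ ι K M m₀ ∣ f := by
  constructor
  · intro hf
    let I := Ideal.span {ι K M m₀}
    have key : (Ideal.Quotient.mkₐ K I) = (Ideal.Quotient.mkₐ K I).comp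
        ((mapLinear s).comp (mapLinear u)) := by
      refine algHom_ext (LinearMap.ext fun m => ?_)
      change Ideal.Quotient.mk I (ι K M m) =
        Ideal.Quotient.mk I (mapLinear s (mapLinear u (ι K M m)))
      rw [mapLinear_ι, mapLinear_ι, Ideal.Quotient.eq, ← map_sub, Ideal.mem_span_singleton]
      have : m - s (u m) ∈ LinearMap.ker u := by
        rw [LinearMap.mem_ker, map_sub, sub_eq_zero]
        exact (LinearMap.congr_fun h (u m)).symm
      rw [hm, Submodule.mem_span_singleton] at this
      obtain ⟨c, hc⟩ := this
      rw [← hc, map_smul, Algebra.smul_def]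
      exact Dvd.intro_left _ rfl
    have := DFunLike.congr_fun key f
    rw [AlgHom.comp_apply, AlgHom.comp_apply, hf, map_zero, map_zero, Ideal.Quotient.mkₐ_eq_mk,
      Ideal.Quotient.eq_zero_iff_mem, Ideal.mem_span_singleton] at this
    exact this
  · rintro ⟨g, rfl⟩
    have : u m₀ = 0 := LinearMap.mem_ker.1 (hm ▸ Submodule.mem_span_singleton_self m₀)
    rw [map_mul, mapLinear_ι, this, map_zero, zero_mul]

theorem not_isUnit_ι (m : M) : ¬ IsUnit (ι K M m) := fun h => by
  have := h.map (algebraMapInv (R := K) (M := M))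
  rw [algebraMapInv_ι] at this
  exact not_isUnit_zero this

/-- Divisibility by `m` is vanishing in the symmetric algebra of `M / K m`, which is a domain. -/
theorem prime_ι {m : M} (hm : m ≠ 0) : Prime (ι K M m) := by
  refine ⟨fun h => hm (ι_eq_zero_iff.1 h), not_isUnit_ι m, fun a b hab => ?_⟩
  obtain ⟨s, hs⟩ := (K ∙ m).mkQ.exists_rightInverse_of_surjective (Submodule.range_mkQ _)
  have hk : LinearMap.ker (K ∙ m).mkQ = K ∙ m := Submodule.ker_mkQ _
  rw [← mapLinear_eq_zero_iff hs hk] at hab ⊢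
  rw [← mapLinear_eq_zero_iff hs hk]
  rw [map_mul] at hab
  exact mul_eq_zero.1 hab

section Derivation

/-- The derivation of the symmetric algebra with prescribed values on the generators. -/
noncomputable def derivationOf (φ : M →ₗ[K] SymmetricAlgebra K M) :
    Derivation K (SymmetricAlgebra K M) (SymmetricAlgebra K M) :=
  let F : SymmetricAlgebra K M →ₐ[K] TrivSqZeroExt (SymmetricAlgebra K M) (SymmetricAlgebra K M) :=
    lift ((TrivSqZeroExt.inlAlgHom K (SymmetricAlgebra K M) (SymmetricAlgebra K M)).toLinearMap ∘ₗ
      ι K M + (TrivSqZeroExt.inrHom (SymmetricAlgebra K M)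
        (SymmetricAlgebra K M)).restrictScalars K ∘ₗ φ)
  have hF : ∀ f, (F f).fst = f := fun f => by
    have : (TrivSqZeroExt.fstHom K (SymmetricAlgebra K M) (SymmetricAlgebra K M)).comp F =
        AlgHom.id K _ := by
      ext m
      simp [F]
    exact DFunLike.congr_fun this f
  Derivation.mk' ((TrivSqZeroExt.sndHom (SymmetricAlgebra K M)
    (SymmetricAlgebra K M)).restrictScalars K ∘ₗ F.toLinearMap) fun a b => by
      simp [hF, mul_comm]

@[simp]
theorem derivationOf_ι (φ : M →ₗ[K] SymmetricAlgebra K M) (m : M) :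
    derivationOf φ (ι K M m) = φ m := by
  simp [derivationOf]

theorem derivation_ext {D₁ D₂ : Derivation K (SymmetricAlgebra K M) (SymmetricAlgebra K M)}
    (h : ∀ m, D₁ (ι K M m) = D₂ (ι K M m)) : D₁ = D₂ := by
  ext f
  induction f using SymmetricAlgebra.induction with
  | algebraMap r => simp
  | ι m => exact h m
  | mul a b ha hb => simp [ha, hb]
  | add a b ha hb => simp [ha, hb]

/-- Quotients are chosen on a basis of `M` only and extended linearly, so they do define a
derivation. -/
theorem exists_smul_eq_of_dvd {D : Derivation K (SymmetricAlgebra K M) (SymmetricAlgebra K M)}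
    {a : SymmetricAlgebra K M} (h : ∀ m, a ∣ D (ι K M m)) :
    ∃ D' : Derivation K (SymmetricAlgebra K M) (SymmetricAlgebra K M), D = a • D' := by
  let b := Module.Free.chooseBasis K M
  choose q hq using fun i => h (b i)
  refine ⟨derivationOf (b.constr K q), derivation_ext fun m => ?_⟩
  have : D.toLinearMap ∘ₗ ι K M = LinearMap.mulLeft K a ∘ₗ b.constr K q := by
    refine b.ext fun i => ?_
    simp [hq, Module.Basis.constr_basis]
  simpa using LinearMap.congr_fun this m

end Derivation

end SymmetricAlgebra

/-! ### Linear forms and restriction of derivations to a hyperplane. -/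

namespace HyperplaneArrangement

variable {K : Type w} [Field K] {V : Type u} [AddCommGroup V] [Module K V]

/-- A linear form, as an element of the coordinate ring. -/
abbrev linForm (α : Module.Dual K V) : CoordRing K V := SymmetricAlgebra.ι K (Module.Dual K V) α

theorem exists_eq_smul_of_ker_le {α β : Module.Dual K V} (h : LinearMap.ker α ≤ LinearMap.ker β) :
    ∃ c : K, β = c • α := by
  by_cases hα : α = 0
  · subst hα
    refine ⟨0, LinearMap.ext fun x => ?_⟩
    simpa using h (x := x) (by simp)
  · obtain ⟨v, hv⟩ : ∃ v, α v ≠ 0 := by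
      by_contra! hc
      exact hα (LinearMap.ext hc)
    refine ⟨β v / α v, LinearMap.ext fun x => ?_⟩
    have : x - (α x / α v) • v ∈ LinearMap.ker α := by
      simp [LinearMap.mem_ker, hv]
    have := h this
    rw [LinearMap.mem_ker, map_sub, map_smul, sub_eq_zero] at this
    rw [this, LinearMap.smul_apply, smul_eq_mul, smul_eq_mul]
    field_simp

theorem exists_ker_eq {H : Submodule K V} (hH : IsCoatom H) :
    ∃ α : Module.Dual K V, LinearMap.ker α = H := by
  obtain ⟨α, hα, hle⟩ := H.exists_le_ker_of_lt_top hH.lt_top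
  refine ⟨α, ((hH.le_iff_eq fun h => hα (LinearMap.ker_eq_top.1 h)).1 hle)⟩

theorem ne_zero_of_isCoatom_ker {α : Module.Dual K V} (h : IsCoatom (LinearMap.ker α)) : α ≠ 0 := by
  rintro rfl
  exact h.1 LinearMap.ker_zero

theorem ker_eq_ker_of_linForm_dvd {α β : Module.Dual K V} (hα : IsCoatom (LinearMap.ker α))
    (hβ : IsCoatom (LinearMap.ker β)) (h : linForm α ∣ linForm β) :
    LinearMap.ker α = LinearMap.ker β := by
  obtain ⟨s, hs⟩ := (K ∙ α).mkQ.exists_rightInverse_of_surjective (Submodule.range_mkQ _)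
  rw [linForm, linForm, ← SymmetricAlgebra.mapLinear_eq_zero_iff hs (Submodule.ker_mkQ _),
    SymmetricAlgebra.mapLinear_ι, SymmetricAlgebra.ι_eq_zero_iff, Submodule.mkQ_apply,
    Submodule.Quotient.mk_eq_zero, Submodule.mem_span_singleton] at h
  obtain ⟨c, rfl⟩ := h
  exact ((hα.le_iff_eq hβ.1).1 (LinearMap.ker_le_ker_smul _ _)).symm

/-- Restriction of polynomial functions from `V` to the subspace `X`. -/
noncomputable def restrictFun (X : Submodule K V) : CoordRing K V →ₐ[K] CoordRing K X :=
  SymmetricAlgebra.mapLinear X.dualRestrict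

theorem restrictFun_linForm (X : Submodule K V) (α : Module.Dual K V) :
    restrictFun X (linForm α) = linForm (X.dualRestrict α) :=
  SymmetricAlgebra.mapLinear_ι _ _

theorem ker_dualRestrict_ker (α : Module.Dual K V) :
    LinearMap.ker (LinearMap.ker α).dualRestrict = K ∙ α := by
  ext β
  rw [Submodule.mem_span_singleton]
  constructor
  · intro hβ
    obtain ⟨c, hc⟩ := exists_eq_smul_of_ker_le (α := α) (β := β) fun x hx =>
      LinearMap.congr_fun (LinearMap.mem_ker.1 hβ) ⟨x, hx⟩
    exact ⟨c, hc.symm⟩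
  · rintro ⟨c, rfl⟩
    rw [LinearMap.mem_ker]
    ext ⟨x, hx⟩
    simpa using Or.inr hx

theorem restrictFun_eq_zero_iff {α : Module.Dual K V} {f : CoordRing K V} :
    restrictFun (LinearMap.ker α) f = 0 ↔ linForm α ∣ f :=
  SymmetricAlgebra.mapLinear_eq_zero_iff (Subspace.dualRestrict_comp_dualLift _)
    (ker_dualRestrict_ker α)

theorem exists_restrictFun_eq (X : Submodule K V) (f : CoordRing K X) :
    ∃ g : CoordRing K V, restrictFun X g = f ∧
      ∀ d, f ∈ homogeneousPart K X d → g ∈ homogeneousPart K V d :=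
  ⟨SymmetricAlgebra.mapLinear (Subspace.dualLift X) f,
    SymmetricAlgebra.mapLinear_mapLinear_of_comp_eq_id (Subspace.dualRestrict_comp_dualLift X) f,
    fun _ h => SymmetricAlgebra.mapLinear_mem h⟩

/-- Since `θ(α)` is a multiple of `α`, the derivation preserves the ideal of `H₀ = ker α` and
induces one on the coordinate ring of `H₀`. Divisibility by the forms of `A` restricts to
divisibility by the forms of `A^{H₀}`. -/
theorem exists_restrict_derivation {A : HyperplaneArrangement K V} {α : Module.Dual K V}
    {θ : Derivation K (CoordRing K V) (CoordRing K V)} (hθ : θ ∈ A.derivationModule)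
    (hα : LinearMap.ker α ∈ A.hyperplanes) :
    ∃ η ∈ (A.restriction (LinearMap.ker α)).derivationModule,
      (∀ β : Module.Dual K V, η (linForm ((LinearMap.ker α).dualRestrict β)) =
        restrictFun (LinearMap.ker α) (θ (linForm β))) ∧
      ∀ d, IsHomogeneousDerivation θ d → IsHomogeneousDerivation η d := by
  set H₀ := LinearMap.ker α with hH₀
  let η := SymmetricAlgebra.derivationOf ((restrictFun H₀).toLinearMap ∘ₗ θ.toLinearMap ∘ₗ
    SymmetricAlgebra.ι K (Module.Dual K V) ∘ₗ Subspace.dualLift H₀)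
  have h1 : ∀ β, η (linForm β) = restrictFun H₀ (θ (linForm (Subspace.dualLift H₀ β))) := by
    intro β
    simp [η, linForm]
  have h2 : ∀ β : Module.Dual K V, η (linForm (H₀.dualRestrict β)) =
      restrictFun H₀ (θ (linForm β)) := by
    intro β
    rw [h1]
    -- Two extensions of a form from `H₀` differ by a multiple of `α`, whose image under `θ`
    -- vanishes on `H₀`; so the chosen lift does not matter.
    have : Subspace.dualLift H₀ (H₀.dualRestrict β) - β ∈ LinearMap.ker H₀.dualRestrict := by
      rw [LinearMap.mem_ker, map_sub, sub_eq_zero]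
      exact LinearMap.congr_fun (Subspace.dualRestrict_comp_dualLift H₀) _
    rw [ker_dualRestrict_ker, Submodule.mem_span_singleton] at this
    obtain ⟨c, hc⟩ := this
    rw [← sub_eq_zero, ← map_sub, ← map_sub, linForm, linForm, ← map_sub, ← hc, map_smul,
      Derivation.map_smul, map_smul, restrictFun_eq_zero_iff.2 (hθ _ hα α rfl), smul_zero]
  refine ⟨η, ?_, h2, fun d hd β => ?_⟩
  · intro L hL β hβ
    obtain ⟨H, hH, hle, rfl⟩ := mem_restriction.1 hL
    obtain ⟨γ, rfl⟩ := exists_ker_eq (A.isCoatom H hH)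
    have hk : LinearMap.ker (H₀.dualRestrict γ) = interIn H₀ (LinearMap.ker γ) := rfl
    obtain ⟨c, rfl⟩ := exists_eq_smul_of_ker_le (α := H₀.dualRestrict γ) (β := β)
      (by rw [hk, hβ])
    have hc0 : c ≠ 0 := by
      rintro rfl
      exact ((A.restriction H₀).isCoatom _ hL).1 (by rw [← hβ]; simp)
    rw [map_smul, Derivation.map_smul, h2, ← linForm, ← restrictFun_linForm, Algebra.smul_def,
      Algebra.smul_def]
    exact mul_dvd_mul_left _ (map_dvd _ (hθ _ hH γ rfl))
  · exact (h1 β).symm ▸ SymmetricAlgebra.mapLinear_mem (hd _)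

/-! ### Independence, degrees and uniqueness of exponents. -/

theorem sum_smul_apply {A : HyperplaneArrangement K V} {ι : Type*} [Fintype ι]
    (g : ι → CoordRing K V) (θ : ι → A.derivationModule) (f : CoordRing K V) :
    (∑ i, g i • θ i : A.derivationModule).1 f = ∑ i, g i * (θ i).1 f := by
  have h1 : (∑ i, g i • θ i : A.derivationModule).1 = ∑ i, g i • (θ i).1 := by
    simp only [Submodule.coe_sum, Submodule.coe_smul]
  have h2 := map_sum (Derivation.coeFnAddMonoidHom (R := K) (A := CoordRing K V)
    (M := CoordRing K V)) (fun i => g i • (θ i).1) Finset.univ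
  rw [h1]
  exact (congrFun h2 f).trans (Finset.sum_apply _ _ _)

theorem _root_.Fintype.card_le_of_forall_sum_smul_eq_zero {R : Type*} [CommRing R] [Nontrivial R]
    {ι κ : Type*} [Fintype ι] [Fintype κ] (v : κ → ι → R)
    (h : ∀ g : κ → R, (∀ i, ∑ j, g j * v j i = 0) → ∀ j, g j = 0) :
    Fintype.card κ ≤ Fintype.card ι := by
  have hli : LinearIndependent R v := Fintype.linearIndependent_iff.2 fun g hg => h g fun i => by
    simpa using congrFun hg i
  have := hli.fintype_card_le_finrank
  rwa [Module.finrank_fintype_fun_eq_card] at this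

theorem eq_zero_of_sum_smul_basis {A : HyperplaneArrangement K V} {ι κ : Type*} [Fintype ι]
    (b : Module.Basis κ (CoordRing K V) A.derivationModule) {v : ι → κ}
    (hv : Function.Injective v) (g : ι → CoordRing K V)
    (h : ∑ i, g i • b (v i) = 0) (i : ι) : g i = 0 := by
  classical
  have := congrArg (fun x => b.repr x (v i)) h
  simp only [map_sum, map_smul, Module.Basis.repr_self, map_zero, Finsupp.zero_apply,
    Finsupp.finsetSum_apply, Finsupp.smul_apply, Finsupp.single_apply, hv.eq_iff, smul_eq_mul] at this
  simpa using this

/-- A basis of `D(A)` stays linearly independent modulo a linear form whose kernel is not in `A`. -/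
theorem dvd_of_dvd_sum {A : HyperplaneArrangement K V} {ι : Type*} [Fintype ι]
    (b : Module.Basis ι (CoordRing K V) A.derivationModule) {α : Module.Dual K V}
    (hα : IsCoatom (LinearMap.ker α)) (hA : LinearMap.ker α ∉ A.hyperplanes)
    (g : ι → CoordRing K V)
    (h : ∀ β, linForm α ∣ ∑ i, g i * (b i).1 (linForm β)) (i : ι) : linForm α ∣ g i := by
  have hval : ∀ β, (∑ i, g i • b i : A.derivationModule).1 (linForm β) =
      ∑ i, g i * (b i).1 (linForm β) := by
    exact fun β => sum_smul_apply g _ _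
  obtain ⟨φ, hφ⟩ := SymmetricAlgebra.exists_smul_eq_of_dvd
    (D := (∑ i, g i • b i : A.derivationModule).1) (a := linForm α)
    fun β => by rw [hval]; exact h β
  -- The form `α` is not associated to any defining form of `A`, so it cancels from the
  -- divisibilities. The coefficients of the combination are then `α` times those of `φ`.
  have hmem : φ ∈ A.derivationModule := by
    intro H hH β hβ
    have h1 := (∑ i, g i • b i : A.derivationModule).2 H hH β hβ
    rw [hφ, Derivation.smul_apply, smul_eq_mul] at h1
    have hβc : IsCoatom (LinearMap.ker β) := hβ ▸ A.isCoatom H hH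
    have hβp := SymmetricAlgebra.prime_ι (K := K) (ne_zero_of_isCoatom_ker hβc)
    refine (hβp.dvd_or_dvd h1).resolve_left fun h2 => hA ?_
    rw [← ker_eq_ker_of_linForm_dvd hβc hα h2, hβ]
    exact hH
  have hsum : ∑ i, g i • b i = linForm α • (⟨φ, hmem⟩ : A.derivationModule) := Subtype.ext hφ
  have := congrArg (fun x => b.repr x i) hsum
  simp only [b.repr_sum_self, map_smul, Finsupp.smul_apply, smul_eq_mul] at this
  exact ⟨_, this⟩

/-- The coefficients of a homogeneous derivation in a homogeneous basis vanish on the basis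
elements of larger degree. -/
theorem repr_eq_zero_of_lt {A : HyperplaneArrangement K V} {ι : Type*} [Fintype ι]
    (b : Module.Basis ι (CoordRing K V) A.derivationModule) {d : ι → ℕ}
    (hd : ∀ i, IsHomogeneousDerivation (b i).1 (d i)) {θ : A.derivationModule} {e : ℕ}
    (hθ : IsHomogeneousDerivation θ.1 e) {i : ι} (hi : e < d i) : b.repr θ i = 0 := by
  -- The degree `e` part of the expansion of `θ` is another expansion of `θ`, with zero coefficients
  -- where `d i > e`; uniqueness of coefficients concludes.
  let c : ι → CoordRing K V := fun i =>
    if d i ≤ e then SymmetricAlgebra.component (e - d i) (b.repr θ i) else 0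
  have hval : ∀ (g : ι → CoordRing K V) β, (∑ i, g i • b i : A.derivationModule).1 (linForm β) =
      ∑ i, g i * (b i).1 (linForm β) := by
    exact fun g β => sum_smul_apply g _ _
  have key : θ = ∑ i, c i • b i := by
    refine Subtype.ext (SymmetricAlgebra.derivation_ext fun β => ?_)
    have h1 : θ.1 (linForm β) = ∑ i, b.repr θ i * (b i).1 (linForm β) := by
      rw [← hval, b.sum_repr]
    have h2 := congrArg (SymmetricAlgebra.component e) h1
    rw [SymmetricAlgebra.component_of_mem (hθ β), SymmetricAlgebra.component_sum] at h2
    change θ.1 (linForm β) = _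
    rw [h2]
    refine Eq.trans ?_ (hval c β).symm
    refine Finset.sum_congr rfl fun j _ => ?_
    rw [mul_comm, SymmetricAlgebra.component_mul_of_mem (hd j β)]
    simp only [c]
    split_ifs
    · rw [mul_comm]
    · rw [zero_mul]
  have := congrArg (fun x => b.repr x i) key
  simp only [b.repr_sum_self] at this
  rw [this]
  exact if_neg (not_le.2 hi)

/-- By `repr_eq_zero_of_lt`, homogeneous elements of degree at most `m` lie in the span of the basis
elements of degree at most `m`, so rank bounds their number. -/
theorem card_le_of_linearIndependent {A : HyperplaneArrangement K V} {ι : Type*} [Fintype ι]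
    (b : Module.Basis ι (CoordRing K V) A.derivationModule) {d : ι → ℕ}
    (hd : ∀ i, IsHomogeneousDerivation (b i).1 (d i)) {m : ℕ} {κ : Type*} [Fintype κ]
    {θ : κ → A.derivationModule}
    (hθ : ∀ g : κ → CoordRing K V, ∑ j, g j • θ j = 0 → ∀ j, g j = 0) {e : κ → ℕ}
    (he : ∀ j, IsHomogeneousDerivation (θ j).1 (e j)) (hm : ∀ j, e j ≤ m) :
    Fintype.card κ ≤ (Finset.univ.filter fun i => d i ≤ m).card := by
  have hzero : ∀ j i, ¬ d i ≤ m → b.repr (θ j) i = 0 := fun j i hi =>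
    repr_eq_zero_of_lt b hd (he j) (lt_of_le_of_lt (hm j) (not_le.1 hi))
  rw [← Fintype.card_subtype]
  refine Fintype.card_le_of_forall_sum_smul_eq_zero
    (fun j (i : {i // d i ≤ m}) => b.repr (θ j) i.1) fun g hg => hθ g ?_
  apply b.repr.injective
  ext i
  rw [map_sum, map_zero, Finsupp.finsetSum_apply]
  simp only [map_smul, Finsupp.smul_apply]
  by_cases hi : d i ≤ m
  · exact hg ⟨i, hi⟩
  · exact Finset.sum_eq_zero fun j _ => by rw [hzero j i hi, smul_zero]

theorem card_filter_le {A : HyperplaneArrangement K V} {ι κ : Type*} [Fintype ι] [Fintype κ]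
    (b : Module.Basis ι (CoordRing K V) A.derivationModule) {d : ι → ℕ}
    (hd : ∀ i, IsHomogeneousDerivation (b i).1 (d i))
    (b' : Module.Basis κ (CoordRing K V) A.derivationModule) {d' : κ → ℕ}
    (hd' : ∀ i, IsHomogeneousDerivation (b' i).1 (d' i)) (m : ℕ) :
    (Finset.univ.filter fun i => d' i ≤ m).card ≤ (Finset.univ.filter fun i => d i ≤ m).card := by
  rw [← Fintype.card_subtype]
  exact card_le_of_linearIndependent b hd
    (θ := fun j : {j // d' j ≤ m} => b' j.1)
    (eq_zero_of_sum_smul_basis b' Subtype.val_injective) (fun j => hd' j.1) fun j => j.2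

/-- Multiplicities are successive differences of the cumulative counts. -/
theorem eq_of_countP_le_eq {s t : Multiset ℕ}
    (h : ∀ m, s.countP (· ≤ m) = t.countP (· ≤ m)) : s = t := by
  have key : ∀ (s : Multiset ℕ) (m : ℕ), s.countP (· ≤ m + 1) = s.countP (· ≤ m) + s.count (m + 1) := by
    intro s m
    induction s using Multiset.induction_on with
    | empty => simp
    | cons a s ih =>
      simp only [Multiset.countP_cons, Multiset.count_cons, ih]
      split_ifs <;> omega
  have key0 : ∀ s : Multiset ℕ, s.countP (· ≤ 0) = s.count 0 := by
    intro s
    simp only [Multiset.count, nonpos_iff_eq_zero, eq_comm]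
  ext m
  cases m with
  | zero => rw [← key0, ← key0, h]
  | succ m =>
    have h1 := h (m + 1)
    rw [key, key, h m] at h1
    omega

theorem countP_map_univ {ι : Type*} [Fintype ι] (d : ι → ℕ) (m : ℕ) :
    (Multiset.map d Finset.univ.val).countP (· ≤ m) =
      (Finset.univ.filter fun i => d i ≤ m).card := by
  rw [Multiset.countP_map]
  rfl

theorem HasHomogeneousBasis.unique {A : HyperplaneArrangement K V} {e e' : Multiset ℕ}
    (h : A.HasHomogeneousBasis e) (h' : A.HasHomogeneousBasis e') : e = e' := by
  obtain ⟨n, b, d, hd, rfl⟩ := h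
  obtain ⟨n', b', d', hd', rfl⟩ := h'
  refine eq_of_countP_le_eq fun m => ?_
  rw [countP_map_univ, countP_map_univ]
  exact le_antisymm (card_filter_le b' hd' b hd m) (card_filter_le b hd b' hd' m)

theorem HasHomogeneousBasis.isFreeWithExponents {A : HyperplaneArrangement K V} {e : Multiset ℕ}
    (h : A.HasHomogeneousBasis e) : A.IsFreeWithExponents e :=
  ⟨h, fun _ h' => h'.unique h⟩

end HyperplaneArrangement

/-! ### Auxiliary facts on divisibility by products, bases and multisets. -/

/-- Cancellation `hc` takes the place of comaximality, which fails for linear forms. It is applied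
both to pairwise non-associated primes and to products of primes. -/
theorem Finset.prod_dvd_of_forall_dvd_of_cancel {R ι : Type*} [CommRing R]
    (s : Finset ι) (q : ι → R) {f : R} (h : ∀ i ∈ s, q i ∣ f)
    (hc : ∀ i ∈ s, ∀ t ⊆ s, i ∉ t → ∀ b, q i ∣ (∏ j ∈ t, q j) * b → q i ∣ b) :
    ∏ i ∈ s, q i ∣ f := by
  classical
  suffices H : ∀ t ⊆ s, ∏ i ∈ t, q i ∣ f from H s subset_rfl
  intro t
  induction t using Finset.induction_on with
  | empty => simp
  | insert a t ha ih =>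
    intro hs
    obtain ⟨g, rfl⟩ := ih ((Finset.subset_insert _ _).trans hs)
    have has : a ∈ s := hs (Finset.mem_insert_self _ _)
    rw [Finset.prod_insert ha, mul_comm]
    exact mul_dvd_mul_left _ (hc a has t ((Finset.subset_insert _ _).trans hs) ha g (h a has))

/-- Repeated or associated primes are allowed, as the forms on `H₀` with a common kernel are
proportional. -/
theorem Finset.prod_prime_dvd_of_dvd_mul {R ι : Type*} [CommRing R] [IsDomain R]
    (s : Finset ι) {p : ι → R} (hp : ∀ i ∈ s, Prime (p i)) {r : R} (hr : ∀ i ∈ s, ¬ p i ∣ r) {b : R}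
    (h : ∏ i ∈ s, p i ∣ r * b) : ∏ i ∈ s, p i ∣ b := by
  classical
  induction s using Finset.induction_on generalizing b with
  | empty => simp
  | insert a s ha ih =>
    rw [Finset.prod_insert ha] at h ⊢
    have hs : ∀ i ∈ s, i ∈ insert a s := fun i => Finset.mem_insert_of_mem
    obtain ⟨c, rfl⟩ := ih (fun i hi => hp i (hs i hi)) (fun i hi => hr i (hs i hi))
      ((Dvd.intro_left _ rfl).trans h)
    have h0 : ∏ i ∈ s, p i ≠ 0 := Finset.prod_ne_zero_iff.2 fun i hi => (hp i (hs i hi)).ne_zero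
    have h1 : p a ∣ r * c := by
      rw [mul_left_comm, mul_comm (p a)] at h
      exact (mul_dvd_mul_iff_left h0).1 h
    have ha' := Finset.mem_insert_self a s
    rw [mul_comm]
    exact mul_dvd_mul_left _ (((hp a ha').dvd_or_dvd h1).resolve_left (hr a ha'))

theorem Module.Basis.exists_of_forall_sum {R M ι : Type*} [CommRing R] [AddCommGroup M]
    [Module R M] [Fintype ι] (θ : ι → M) (hli : ∀ g : ι → R, ∑ i, g i • θ i = 0 → ∀ i, g i = 0)
    (hs : ∀ x, ∃ g : ι → R, ∑ i, g i • θ i = x) : ∃ b : Module.Basis ι R M, ∀ i, b i = θ i := by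
  refine ⟨Module.Basis.mk (Fintype.linearIndependent_iff.2 hli) fun x _ => ?_, fun i => ?_⟩
  · exact (Submodule.mem_span_range_iff_exists_fun R).2 (hs x)
  · exact Module.Basis.mk_apply _ _ _

theorem Finset.sum_smul_sub_smul {R M ι : Type*} [CommRing R] [AddCommGroup M]
    [Module R M] [Fintype ι] [DecidableEq ι] (g t : ι → R) (b : ι → M) (i : ι) :
    ∑ j, g j • (b j - t j • b i) = ∑ j, (g j - if j = i then ∑ l, g l * t l else 0) • b j := by
  simp only [smul_sub, sub_smul, Finset.sum_sub_distrib, ite_smul, zero_smul,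
    Finset.sum_ite_eq', Finset.mem_univ, if_true, smul_smul, ← Finset.sum_smul]

theorem Multiset.map_update_univ {ι α : Type*} [Fintype ι] [DecidableEq ι] (d : ι → α) (i : ι)
    (a : α) {e : Multiset α} (h : Multiset.map d Finset.univ.val = d i ::ₘ e) :
    Multiset.map (Function.update d i a) Finset.univ.val = a ::ₘ e := by
  have hi : i ∈ (Finset.univ : Finset ι).val := Finset.mem_univ i
  have hn : i ∉ (Finset.univ : Finset ι).val.erase i :=
    (Finset.univ : Finset ι).nodup.notMem_erase
  rw [← Multiset.cons_erase hi, Multiset.map_cons] at h ⊢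
  rw [Multiset.cons_inj_right] at h
  rw [Function.update_self, ← h]
  congr 1
  refine Multiset.map_congr rfl fun j hj => Function.update_of_ne ?_ _ _
  rintro rfl
  exact hn hj

/-! ### The addition theorem and Terao's polynomial. -/

namespace HyperplaneArrangement

variable {K : Type w} [Field K] {V : Type u} [AddCommGroup V] [Module K V]

theorem mem_derivationModule_iff_deletion {A : HyperplaneArrangement K V} {α : Module.Dual K V}
    (hα : LinearMap.ker α ∈ A.hyperplanes)
    {θ : Derivation K (CoordRing K V) (CoordRing K V)} :
    θ ∈ A.derivationModule ↔ θ ∈ (A.deletion (LinearMap.ker α)).derivationModule ∧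
      linForm α ∣ θ (linForm α) := by
  refine ⟨fun h => ⟨fun H hH => h H hH.1, h _ hα α rfl⟩, fun ⟨h1, h2⟩ H hH γ hγ => ?_⟩
  by_cases e : H = LinearMap.ker α
  · obtain ⟨c, rfl⟩ := exists_eq_smul_of_ker_le (α := α) (β := γ) (by rw [hγ, e])
    rw [map_smul, Derivation.map_smul, Algebra.smul_def, Algebra.smul_def]
    exact mul_dvd_mul_left _ h2
  · exact h1 H ⟨hH, e⟩ γ hγ

/-- A counting argument. If every basis element of degree at most `N` were tangent to `ker α`, all
of them would restrict to derivations of the restriction. These stay independent by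
`dvd_of_dvd_sum`, since `ker α` is not in the deletion, but there is one more of them than there are
exponents at most `N` in `e`. -/
theorem exists_degree_le_of_deletion {A : HyperplaneArrangement K V} {α : Module.Dual K V}
    (hα : LinearMap.ker α ∈ A.hyperplanes) {n : ℕ}
    (b : Module.Basis (Fin n) (CoordRing K V) (A.deletion (LinearMap.ker α)).derivationModule)
    {d : Fin n → ℕ} (hd : ∀ i, IsHomogeneousDerivation (b i).1 (d i)) {N : ℕ} {e : Multiset ℕ}
    (he : Multiset.map d Finset.univ.val = N ::ₘ e)
    (h'' : (A.restriction (LinearMap.ker α)).HasHomogeneousBasis e) :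
    ∃ i, d i ≤ N ∧ restrictFun (LinearMap.ker α) ((b i).1 (linForm α)) ≠ 0 := by
  by_contra! hcon
  obtain ⟨n'', b'', d'', hd'', rfl⟩ := h''
  have hmem : ∀ i : {i // d i ≤ N}, (b i.1).1 ∈ A.derivationModule := fun i =>
    (mem_derivationModule_iff_deletion hα).2 ⟨(b i.1).2, restrictFun_eq_zero_iff.1 (hcon _ i.2)⟩
  choose η hη hηr hηd using fun i : {i // d i ≤ N} => exists_restrict_derivation (hmem i) hα
  have hcard := card_le_of_linearIndependent b'' hd'' (κ := {i // d i ≤ N})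
    (θ := fun i => ⟨η i, hη i⟩) ?_ (e := fun i => d i.1) (fun i => hηd i _ (hd i.1)) fun i => i.2
  · have h1 := congrArg (Multiset.countP (· ≤ N)) he
    rw [Multiset.countP_cons_of_pos (p := (· ≤ N)) _ le_rfl, countP_map_univ, countP_map_univ] at h1
    rw [Fintype.card_subtype] at hcard
    omega
  · intro g hg j
    choose g' hg' _ using fun i => exists_restrictFun_eq (LinearMap.ker α) (g i)
    have hcoat := A.isCoatom _ hα
    -- A relation on `ker α` is lifted to `V` and extended by zero to the basis elements of degree
    -- above `N`.
    have key := dvd_of_dvd_sum b hcoat (fun h => h.2 rfl)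
      (fun i => if hi : d i ≤ N then g' ⟨i, hi⟩ else 0) (fun β => ?_) j.1
    · rw [dif_pos j.2] at key
      rw [← hg' j, restrictFun_eq_zero_iff]
      exact key
    · rw [← restrictFun_eq_zero_iff, map_sum]
      have h2 := sum_smul_apply g (fun i => (⟨η i, hη i⟩ :
        (A.restriction (LinearMap.ker α)).derivationModule))
        (linForm ((LinearMap.ker α).dualRestrict β))
      rw [hg] at h2
      have h3 : ∑ i, g i * restrictFun (LinearMap.ker α) ((b i.1).1 (linForm β)) = 0 := by
        refine Eq.trans ?_ h2.symm
        exact Finset.sum_congr rfl fun i _ => by rw [hηr]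
      rw [← h3, ← Finset.sum_filter_add_sum_filter_not Finset.univ (fun i => d i ≤ N),
        Finset.sum_eq_zero (s := Finset.univ.filter fun i => ¬ d i ≤ N), add_zero]
      · rw [← Finset.sum_subtype_eq_sum_filter, Finset.subtype_univ]
        refine Finset.sum_congr rfl fun i _ => ?_
        rw [dif_pos i.2, map_mul, hg']
      · intro i hi
        rw [dif_neg (Finset.mem_filter.1 hi).2, zero_mul, map_zero]

/-- Comparing components of degree `m` replaces the quotient by its component of degree `m - N`,
which is then lifted to `V`. For `m < N` that component is absent, so `f` vanishes on `ker α` and `k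
= 0`. -/
theorem exists_homogeneous_quotient {α : Module.Dual K V} {N m : ℕ}
    {B : CoordRing K (LinearMap.ker α)} (hB : B ∈ homogeneousPart K (LinearMap.ker α) N)
    {f : CoordRing K V} (hf : f ∈ homogeneousPart K V m)
    (h : B ∣ restrictFun (LinearMap.ker α) f) :
    ∃ k : CoordRing K V, restrictFun (LinearMap.ker α) f = B * restrictFun (LinearMap.ker α) k ∧
      (m < N → k = 0) ∧ (N ≤ m → k ∈ homogeneousPart K V (m - N)) := by
  obtain ⟨q, hq⟩ := h
  have hr : restrictFun (LinearMap.ker α) f ∈ homogeneousPart K (LinearMap.ker α) m :=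
    SymmetricAlgebra.mapLinear_mem hf
  have h1 := SymmetricAlgebra.component_mul_of_mem hB q m
  rw [← hq, SymmetricAlgebra.component_of_mem hr] at h1
  by_cases hm : N ≤ m
  · rw [if_pos hm] at h1
    obtain ⟨k, hk, hkm⟩ := exists_restrictFun_eq (LinearMap.ker α)
      (SymmetricAlgebra.component (m - N) q)
    exact ⟨k, by rw [h1, hk], fun h => (not_le.2 h hm).elim,
      fun _ => hkm _ (SymmetricAlgebra.component_mem _ _)⟩
  · rw [if_neg hm] at h1
    exact ⟨0, by rw [h1, map_zero, mul_zero], fun _ => rfl, fun h => (hm h).elim⟩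

set_option maxHeartbeats 1000000 in
/-- The addition theorem. -/
theorem HasHomogeneousBasis.addition {A : HyperplaneArrangement K V} {α : Module.Dual K V}
    (hα : LinearMap.ker α ∈ A.hyperplanes) {N : ℕ} {B : CoordRing K (LinearMap.ker α)}
    (hB : B ∈ homogeneousPart K (LinearMap.ker α) N) (hB0 : B ≠ 0)
    (hdvd : ∀ θ ∈ (A.deletion (LinearMap.ker α)).derivationModule,
      B ∣ restrictFun (LinearMap.ker α) (θ (linForm α))) {e : Multiset ℕ}
    (h' : (A.deletion (LinearMap.ker α)).HasHomogeneousBasis (N ::ₘ e))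
    (h'' : (A.restriction (LinearMap.ker α)).HasHomogeneousBasis e) :
    A.HasHomogeneousBasis ((N + 1) ::ₘ e) := by
  classical
  obtain ⟨n, b, d, hd, he⟩ := h'
  obtain ⟨i, hiN, hi0⟩ := exists_degree_le_of_deletion hα b hd he.symm h''
  choose k hk hklt hkle using fun j => exists_homogeneous_quotient hB (hd j α) (hdvd _ (b j).2)
  -- A non-zero multiple of `B` has degree at least `N`, so `d i = N` and the quotient `k i` is a
  -- non-zero constant `c`. Dividing all quotients by `c` normalizes `s i` to `1`.
  have hiN' : d i = N := by
    refine le_antisymm hiN (not_lt.1 fun hlt => hi0 ?_)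
    rw [hk, hklt i hlt, map_zero, mul_zero]
  obtain ⟨c, hc⟩ : ∃ c : K, algebraMap K (CoordRing K V) c = k i := by
    have := hkle i hiN'.ge
    rw [hiN', Nat.sub_self, homogeneousPart, pow_zero] at this
    exact Submodule.mem_one.1 this
  have hc0 : c ≠ 0 := by
    rintro rfl
    rw [map_zero] at hc
    exact hi0 (by rw [hk, ← hc, map_zero, mul_zero])
  have hα0 := ne_zero_of_isCoatom_ker (A.isCoatom _ hα)
  have hp := SymmetricAlgebra.prime_ι (K := K) hα0
  obtain ⟨s, hs⟩ : ∃ s : Fin n → CoordRing K V, ∀ j, s j = c⁻¹ • k j := ⟨_, fun _ => rfl⟩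
  have hsi : s i = 1 := by
    rw [hs, ← hc, Algebra.algebraMap_eq_smul_one, smul_smul, inv_mul_cancel₀ hc0, one_smul]
  have hks : ∀ j, k j = c • s j := fun j => by
    rw [hs, smul_smul, mul_inv_cancel₀ hc0, one_smul]
  -- With `t i = 1 - α` the single formula `b j - t j • b i` yields `α • b i` at `j = i` and, for `j
  -- ≠ i`, an element whose value at `α` vanishes on `ker α`.
  let t : Fin n → CoordRing K V := fun j => if j = i then 1 - linForm α else s j
  have hti : t i = 1 - linForm α := if_pos rfl
  have htj : ∀ j, j ≠ i → t j = s j := fun j hj => if_neg hj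
  let θ' : Fin n → (A.deletion (LinearMap.ker α)).derivationModule := fun j => b j - t j • b i
  have hθapp : ∀ j f, (θ' j).1 f = (b j).1 f - t j * (b i).1 f := fun j f => rfl
  have hrest : ∀ j, restrictFun (LinearMap.ker α) (t j) = restrictFun (LinearMap.ker α) (s j) := by
    intro j
    by_cases hj : j = i
    · subst hj
      rw [hti, hsi, map_sub, restrictFun_eq_zero_iff.2 dvd_rfl, sub_zero]
    · rw [htj j hj]
  have hmem : ∀ j, (θ' j).1 ∈ A.derivationModule := by
    intro j
    refine (mem_derivationModule_iff_deletion hα).2 ⟨(θ' j).2, restrictFun_eq_zero_iff.1 ?_⟩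
    rw [hθapp, map_sub, map_mul, hk, hk, hrest, hks j, hks i, hsi, map_smul, map_smul, map_one]
    simp only [Algebra.smul_def]
    ring
  let θ : Fin n → A.derivationModule := fun j => ⟨(θ' j).1, hmem j⟩
  have hsum : ∀ g : Fin n → CoordRing K V, ∑ j, g j • θ' j =
      ∑ j, (g j - if j = i then ∑ l, g l * t l else 0) • b j := by
    intro g
    exact Finset.sum_smul_sub_smul g t b i
  have hcoe : ∀ g : Fin n → CoordRing K V, (∑ j, g j • θ j : A.derivationModule).1 =
      (∑ j, g j • θ' j : (A.deletion (LinearMap.ker α)).derivationModule).1 := by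
    intro g
    simp only [Submodule.coe_sum, Submodule.coe_smul, θ]
  have hli : ∀ g : Fin n → CoordRing K V, ∑ j, g j • θ j = 0 → ∀ j, g j = 0 := by
    intro g hg
    have h1 : ∑ j, g j • θ' j = 0 := Subtype.ext (by rw [← hcoe, hg]; rfl)
    rw [hsum] at h1
    have h2 := eq_zero_of_sum_smul_basis b Function.injective_id _ h1
    have h3 : ∀ j, j ≠ i → g j = 0 := fun j hj => by simpa [hj] using h2 j
    have h4 := h2 i
    rw [if_pos rfl, Finset.sum_eq_single i (fun j _ hj => by rw [h3 j hj, zero_mul])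
      (fun h => (h (Finset.mem_univ i)).elim), hti] at h4
    have h5 : g i * linForm α = 0 := by linear_combination h4
    intro j
    by_cases hj : j = i
    · rw [hj]
      exact (mul_eq_zero.1 h5).resolve_right hp.ne_zero
    · exact h3 j hj
  have hspan : ∀ x, ∃ g : Fin n → CoordRing K V, ∑ j, g j • θ j = x := by
    intro x
    obtain ⟨hx1, hx2⟩ := (mem_derivationModule_iff_deletion hα).1 x.2
    set f := fun j => b.repr ⟨x.1, hx1⟩ j with hf
    have hxf : ∑ j, f j • b j = ⟨x.1, hx1⟩ := b.sum_repr _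
    -- On `ker α` the value of `x` at `α` is `c B` times this sum; it vanishes and `B ≠ 0`. The
    -- quotient by `α` is the coefficient of `α • b i`.
    have h1 : linForm α ∣ ∑ j, f j * s j := by
      rw [← restrictFun_eq_zero_iff] at hx2 ⊢
      have h2 : x.1 (linForm α) = ∑ j, f j * (b j).1 (linForm α) := by
        rw [← sum_smul_apply, hxf]
      rw [h2, map_sum] at hx2
      have h3 : B * (c • restrictFun (LinearMap.ker α) (∑ j, f j * s j)) = 0 := by
        rw [← hx2, map_sum, Finset.smul_sum, Finset.mul_sum]
        refine Finset.sum_congr rfl fun j _ => ?_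
        rw [map_mul, map_mul, hk, hks, map_smul, mul_smul_comm, mul_smul_comm, mul_smul_comm,
          mul_left_comm]
      exact (smul_eq_zero.1 ((mul_eq_zero.1 h3).resolve_left hB0)).resolve_left hc0
    obtain ⟨q, hq⟩ := h1
    refine ⟨Function.update f i q, Subtype.ext ?_⟩
    rw [hcoe, hsum]
    refine Eq.trans (congrArg Subtype.val ?_) (congrArg Subtype.val hxf)
    refine Finset.sum_congr rfl fun j _ => ?_
    congr 1
    have h4 : ∑ l, Function.update f i q l * t l = q - f i := by
      rw [← Finset.add_sum_erase _ _ (Finset.mem_univ i)] at hq ⊢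
      rw [Function.update_self, hti, Finset.sum_congr rfl (g := fun l => f l * s l)]
      · rw [hsi] at hq
        linear_combination hq
      · intro l hl
        rw [Function.update_of_ne (Finset.ne_of_mem_erase hl), htj l (Finset.ne_of_mem_erase hl)]
    rw [h4]
    by_cases hj : j = i
    · subst hj
      simp
    · simp [hj]
  obtain ⟨b₁, hb₁⟩ := Module.Basis.exists_of_forall_sum (R := CoordRing K V) θ hli hspan
  refine ⟨n, b₁, Function.update d i (N + 1), fun j => ?_, ?_⟩
  · rw [hb₁]
    intro β
    change (θ' j).1 (linForm β) ∈ _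
    rw [hθapp]
    by_cases hj : j = i
    · subst hj
      rw [Function.update_self, hti, sub_mul, one_mul, sub_sub_cancel, add_comm N]
      exact SymmetricAlgebra.mul_mem_range_pow (SymmetricAlgebra.ι_mem_range_pow_one _)
        (hiN' ▸ hd j β)
    · rw [Function.update_of_ne hj, htj j hj]
      refine sub_mem (hd j β) ?_
      rw [hs]
      by_cases hlt : d j < N
      · simp only [hklt j hlt, smul_zero, zero_mul]
        exact zero_mem _
      · have h1 := SymmetricAlgebra.mul_mem_range_pow
          (Submodule.smul_mem _ c⁻¹ (hkle j (not_lt.1 hlt))) (hd i β)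
        rwa [hiN', Nat.sub_add_cancel (not_lt.1 hlt)] at h1
  · exact (Multiset.map_update_univ d i (N + 1) (by rw [hiN', he])).symm

/-- The factors of `B` are grouped by their trace `X = H ∩ H₀`. Within a group they are proportional
on `H₀`, so divisibility by their product must be proved on `V`, where they are pairwise
non-associated. Surjectivity of the restriction map supplies `L ∉ B₀` with the same trace, and `L`
yields one element of `S` divisible by all forms of the group and agreeing with `θ(α₀)` on `H₀`.
Factors from different groups are coprime on `H₀`. -/
theorem exists_product_dvd {A : HyperplaneArrangement K V} {B₀ : Set (Submodule K V)}
    (hB₀ : B₀ ⊆ A.hyperplanes) {α₀ : Module.Dual K V} (hα₀ : LinearMap.ker α₀ ∈ B₀)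
    (bij : Set.BijOn (interIn (LinearMap.ker α₀)) (A.hyperplanes \ B₀)
      (A.restriction (LinearMap.ker α₀)).hyperplanes) :
    ∃ B ∈ homogeneousPart K (LinearMap.ker α₀) (B₀ \ {LinearMap.ker α₀}).ncard, B ≠ 0 ∧
      ∀ θ ∈ (A.deletion (LinearMap.ker α₀)).derivationModule,
        B ∣ restrictFun (LinearMap.ker α₀) (θ (linForm α₀)) := by
  classical
  set H₀ := LinearMap.ker α₀ with hH₀
  have hex : ∀ H : Submodule K V, ∃ α : Module.Dual K V, H ∈ A.hyperplanes → LinearMap.ker α = H := by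
    intro H
    by_cases hH : H ∈ A.hyperplanes
    · obtain ⟨α, hα⟩ := exists_ker_eq (A.isCoatom H hH)
      exact ⟨α, fun _ => hα⟩
    · exact ⟨0, fun h => (hH h).elim⟩
  choose a ha using hex
  have hfin : (B₀ \ {H₀}).Finite := (A.finite.subset hB₀).subset Set.sdiff_subset
  let T := hfin.toFinset
  have hT : ∀ H ∈ T, H ∈ B₀ ∧ H ≠ H₀ := fun H hH => hfin.mem_toFinset.1 hH
  have hTA : ∀ H ∈ T, H ∈ A.hyperplanes := fun H hH => hB₀ (hT H hH).1
  have hker : ∀ H ∈ A.hyperplanes, LinearMap.ker (H₀.dualRestrict (a H)) = interIn H₀ H := by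
    intro H hH
    conv_rhs => rw [← ha H hH]
    rfl
  have hres : ∀ H ∈ A.hyperplanes, H ≠ H₀ → interIn H₀ H ∈ (A.restriction H₀).hyperplanes := by
    intro H hH hne
    refine mem_restriction.2 ⟨H, hH, fun hle => hne ?_, rfl⟩
    exact ((A.isCoatom _ (hB₀ hα₀)).le_iff_eq (A.isCoatom _ hH).1).1 hle
  have hco : ∀ H ∈ T, IsCoatom (LinearMap.ker (H₀.dualRestrict (a H))) := by
    intro H hH
    rw [hker H (hTA H hH)]
    exact (A.restriction H₀).isCoatom _ (hres H (hTA H hH) (hT H hH).2)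
  have hprime : ∀ H ∈ T, Prime (linForm (H₀.dualRestrict (a H))) := fun H hH =>
    SymmetricAlgebra.prime_ι (ne_zero_of_isCoatom_ker (hco H hH))
  refine ⟨∏ H ∈ T, linForm (H₀.dualRestrict (a H)), ?_, ?_, ?_⟩
  · rw [Set.ncard_eq_toFinset_card _ hfin]
    exact SymmetricAlgebra.prod_mem_range_pow T _
  · exact Finset.prod_ne_zero_iff.2 fun H hH => (hprime H hH).ne_zero
  intro θ hθ
  rw [← Finset.prod_fiberwise_of_maps_to (t := T.image (interIn H₀)) (g := interIn H₀)
    fun H hH => Finset.mem_image_of_mem _ hH]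
  refine Finset.prod_dvd_of_forall_dvd_of_cancel _ _ ?_ ?_
  · intro X hX
    obtain ⟨H₁, hH₁, rfl⟩ := Finset.mem_image.1 hX
    obtain ⟨L, ⟨hLA, hLB⟩, hLX⟩ := bij.surjOn (hres H₁ (hTA H₁ hH₁) (hT H₁ hH₁).2)
    have hLne : L ≠ H₀ := fun h => hLB (h ▸ hα₀)
    obtain ⟨g, hg⟩ := hθ L ⟨hLA, hLne⟩ (a L) (ha L hLA)
    -- Write `α_H = x α_L + y α₀` and `θ(α_L) = α_L g`. Then `θ(α_H) = α_H g + y (θ(α₀) - α₀ g)`,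
    -- and `α_H` divides the left side.
    have hdvd : ∏ H ∈ T with interIn H₀ H = interIn H₀ H₁, linForm (a H) ∣
        θ (linForm α₀) - linForm α₀ * g := by
      have hsub : ∀ H ∈ T.filter (fun H => interIn H₀ H = interIn H₀ H₁), H ∈ T ∧
        interIn H₀ H = interIn H₀ H₁ := fun H hH => Finset.mem_filter.1 hH
      have hcoat : ∀ H ∈ T, IsCoatom (LinearMap.ker (a H)) := fun H hH => by
        rw [ha H (hTA H hH)]
        exact A.isCoatom H (hTA H hH)
      have hpr : ∀ H ∈ T, Prime (linForm (a H)) := fun H hH =>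
        SymmetricAlgebra.prime_ι (ne_zero_of_isCoatom_ker (hcoat H hH))
      refine Finset.prod_dvd_of_forall_dvd_of_cancel _ _ ?_ ?_
      · intro H hH
        obtain ⟨hHT, hHX⟩ := hsub H hH
        obtain ⟨x, hx⟩ := exists_eq_smul_of_ker_le (α := H₀.dualRestrict (a L))
          (β := H₀.dualRestrict (a H))
          (by rw [hker L hLA, hker H (hTA H hHT), hLX, hHX])
        have hmem : a H - x • a L ∈ LinearMap.ker H₀.dualRestrict := by
          rw [LinearMap.mem_ker, map_sub, map_smul, hx, sub_self]
        rw [ker_dualRestrict_ker, Submodule.mem_span_singleton] at hmem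
        obtain ⟨y, hy⟩ := hmem
        -- Otherwise `H = L`, although `H ∈ B₀` and `L ∉ B₀`.
        have hy0 : y ≠ 0 := by
          rintro rfl
          rw [zero_smul, eq_comm, sub_eq_zero] at hy
          have hle : L ≤ H := by
            rw [← ha L hLA, ← ha H (hTA H hHT), hy]
            exact LinearMap.ker_le_ker_smul _ _
          have hLH := ((A.isCoatom _ hLA).le_iff_eq (A.isCoatom _ (hTA H hHT)).1).1 hle
          exact hLB (hLH ▸ (hT H hHT).1)
        have hdH := hθ H ⟨hTA H hHT, (hT H hHT).2⟩ (a H) (ha H (hTA H hHT))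
        have hform : linForm (a H) = x • linForm (a L) + y • linForm α₀ := by
          simp only [linForm]
          rw [← map_smul, ← map_smul, ← map_add, hy]
          congr 1
          abel
        have hval : θ (linForm (a H)) = linForm (a H) * g + y • (θ (linForm α₀) - linForm α₀ * g) := by
          rw [hform, map_add, Derivation.map_smul, Derivation.map_smul, hg]
          simp only [Algebra.smul_def]
          ring
        change linForm (a H) ∣ θ (linForm (a H)) at hdH
        rw [hval, dvd_add_right (Dvd.intro _ rfl)] at hdH
        have := hdH.mul_left (algebraMap K (CoordRing K V) y⁻¹)
        rwa [← Algebra.smul_def, smul_smul, inv_mul_cancel₀ hy0, one_smul] at this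
      · intro H hH t ht hHt r hr
        refine ((hpr H (hsub H hH).1).dvd_or_dvd hr).resolve_left fun h => hHt ?_
        obtain ⟨H', hH', hd⟩ := ((hpr H (hsub H hH).1).dvd_finsetProd_iff _).1 h
        have hH'T := (hsub H' (ht hH')).1
        have := ker_eq_ker_of_linForm_dvd (hcoat H (hsub H hH).1) (hcoat H' hH'T) hd
        rw [ha _ (hTA _ (hsub H hH).1), ha _ (hTA _ hH'T)] at this
        exact this ▸ hH'
    have h1 := map_dvd (restrictFun H₀) hdvd
    rw [map_prod, map_sub, map_mul, restrictFun_eq_zero_iff.2 dvd_rfl, zero_mul, sub_zero] at h1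
    simpa only [restrictFun_linForm] using h1
  · intro X hX t ht hXt r hr
    refine Finset.prod_prime_dvd_of_dvd_mul _ (fun H hH => hprime H (Finset.mem_filter.1 hH).1) ?_ hr
    intro H hH hd
    obtain ⟨hHT, hHX⟩ := Finset.mem_filter.1 hH
    obtain ⟨Y, hY, hd⟩ := ((hprime H hHT).dvd_finsetProd_iff _).1 hd
    obtain ⟨H', hH', hd⟩ := ((hprime H hHT).dvd_finsetProd_iff _).1 hd
    obtain ⟨hHT', hHY⟩ := Finset.mem_filter.1 hH'
    have := ker_eq_ker_of_linForm_dvd (hco H hHT) (hco H' hHT') hd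
    rw [hker _ (hTA _ hHT), hker _ (hTA _ hHT'), hHX, hHY] at this
    exact hXt (this ▸ hY)

end HyperplaneArrangement

/-! ### Exponents of inductively factored arrangements as block sizes. -/

namespace HyperplaneArrangement

variable {K : Type w} [Field K]

/-- The partial derivatives along a basis of the dual space are a basis of degree zero. -/
theorem hasHomogeneousBasis_empty (V : Type u) [AddCommGroup V] [Module K V]
    [FiniteDimensional K V] :
    (HyperplaneArrangement.empty K V).HasHomogeneousBasis
      (Multiset.replicate (Module.finrank K V) 0) := by
  let c := Module.finBasis K (Module.Dual K V)
  let θ : Fin (Module.finrank K (Module.Dual K V)) →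
      (HyperplaneArrangement.empty K V).derivationModule := fun i =>
    ⟨SymmetricAlgebra.derivationOf (Algebra.linearMap K (CoordRing K V) ∘ₗ c.coord i),
      fun _ h => h.elim⟩
  have hθ : ∀ i β, (θ i).1 (linForm β) = algebraMap K (CoordRing K V) (c.coord i β) := fun i β =>
    SymmetricAlgebra.derivationOf_ι _ _
  have hsum : ∀ (g : Fin (Module.finrank K (Module.Dual K V)) → CoordRing K V) j,
      (∑ i, g i • θ i : (HyperplaneArrangement.empty K V).derivationModule).1 (linForm (c j)) =
        g j := by
    intro g j
    rw [sum_smul_apply, Finset.sum_eq_single j]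
    · rw [hθ, Module.Basis.coord_apply, c.repr_self, Finsupp.single_eq_same, map_one, mul_one]
    · intro i _ hi
      rw [hθ, Module.Basis.coord_apply, c.repr_self, Finsupp.single_eq_of_ne hi, map_zero, mul_zero]
    · exact fun h => (h (Finset.mem_univ j)).elim
  obtain ⟨b, hb⟩ := Module.Basis.exists_of_forall_sum (R := CoordRing K V) θ
    (fun g hg j => by
      rw [← hsum g j, hg]
      rfl)
    (fun x => by
      refine ⟨fun i => x.1 (linForm (c i)), Subtype.ext (SymmetricAlgebra.derivation_ext fun β => ?_)⟩
      have : (∑ i, x.1 (linForm (c i)) • θ i :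
          (HyperplaneArrangement.empty K V).derivationModule).1.toLinearMap ∘ₗ
            SymmetricAlgebra.ι K (Module.Dual K V) =
          x.1.toLinearMap ∘ₗ SymmetricAlgebra.ι K (Module.Dual K V) :=
        c.ext fun j => hsum (fun i => x.1 (linForm (c i))) j
      exact LinearMap.congr_fun this β)
  refine ⟨_, b, fun _ => 0, fun i β => ?_, ?_⟩
  · rw [hb]
    change (θ i).1 (linForm β) ∈ _
    rw [hθ, homogeneousPart, pow_zero]
    exact Submodule.algebraMap_mem _
  · rw [Multiset.map_const', ← Subspace.dual_finrank_eq (K := K) (V := V)]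
    simp

/-- The multiset of the sizes of the members of `P`. -/
noncomputable def blockSizes {α : Type u} (P : Set (Set α)) : Multiset ℕ :=
  ∑ᶠ B ∈ P, {B.ncard}

theorem blockSizes_insert {α : Type u} {P : Set (Set α)} {B : Set α} (hB : B ∉ P)
    (hP : P.Finite) : blockSizes (insert B P) = B.ncard ::ₘ blockSizes P := by
  rw [blockSizes, finsum_mem_insert _ hB hP, Multiset.singleton_add]
  rfl

theorem blockSizes_eq_cons {α : Type u} {P : Set (Set α)} {B : Set α} (hB : B ∈ P)
    (hP : P.Finite) : blockSizes P = B.ncard ::ₘ blockSizes (P \ {B}) := by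
  have hn : B ∉ P \ {B} := fun h => h.2 rfl
  rw [← blockSizes_insert hn (hP.subset Set.sdiff_subset), Set.insert_sdiff_singleton,
    Set.insert_eq_of_mem hB]

theorem blockSizes_image {α : Type u} {β : Type v} {P : Set (Set α)} {F : Set α → Set β}
    (hF : Set.InjOn F P) (h : ∀ B ∈ P, (F B).ncard = B.ncard) :
    blockSizes (F '' P) = blockSizes P := by
  rw [blockSizes, finsum_mem_image hF]
  exact finsum_mem_congr rfl fun B hB => by rw [h B hB]

theorem inducedPartition_sdiff_singleton {α : Type u} {P : Set (Set α)} {s : Set α}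
    (hP : IsPartitionOf P s) {B₀ : Set α} (hB₀ : B₀ ∈ P) {a : α} (ha : a ∈ B₀) :
    inducedPartition P (s \ {a}) =
      {C | C.Nonempty ∧ C = B₀ \ {a}} ∪ (P \ {B₀}) := by
  have h0 : ∀ B ∈ P, B ∩ (s \ {a}) = B \ {a} := fun B hB => by
    rw [← Set.inter_sdiff_assoc, Set.inter_eq_left.2 (hP.subset hB)]
  have h1 : ∀ B ∈ P, B ≠ B₀ → B \ {a} = B := fun B hB hne =>
    Set.sdiff_singleton_eq_self fun h => hne (hP.eq_of_mem hB hB₀ h ha)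
  ext C
  constructor
  · rintro ⟨hne, B, hB, rfl⟩
    rw [h0 B hB] at hne ⊢
    by_cases e : B = B₀
    · exact Or.inl ⟨hne, by rw [e]⟩
    · rw [h1 B hB e]
      exact Or.inr ⟨hB, e⟩
  · rintro (⟨hne, rfl⟩ | ⟨hC, hne⟩)
    · exact ⟨hne, B₀, hB₀, (h0 B₀ hB₀).symm⟩
    · exact ⟨hP.nonempty hC, C, hC, by rw [h0 C hC, h1 C hC hne]⟩

/-- In the addition step, `N + 1` is the size of the block of `H₀`. The other blocks keep their
sizes in the restriction because the restriction map is injective off `B₀`, so deletion and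
restriction have the exponents that `HasHomogeneousBasis.addition` requires. -/
theorem IsInductiveFactorization.hasHomogeneousBasis {V : Type u} [AddCommGroup V] [Module K V]
    {A : HyperplaneArrangement K V} {P : Set (Set (Submodule K V))}
    (h : IsInductiveFactorization A P) : ∀ [FiniteDimensional K V],
      ∃ z, z + P.ncard = Module.finrank K V ∧
        A.HasHomogeneousBasis (blockSizes P + Multiset.replicate z 0) := by
  induction h with
  | empty V =>
    intro _
    refine ⟨Module.finrank K V, by simp, ?_⟩
    have : blockSizes (∅ : Set (Set (Submodule K V))) = 0 := finsum_mem_empty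
    rw [this, zero_add]
    exact hasHomogeneousBasis_empty V
  | @step V _ _ A P hP B₀ hB₀ H₀ hH₀ bij _ _ ihd ihr =>
    intro _
    obtain ⟨α, rfl⟩ := exists_ker_eq (A.isCoatom _ (hP.subset hB₀ hH₀))
    have hα := hP.subset hB₀ hH₀
    have hPf := hP.finite A.finite
    have hBf : B₀.Finite := A.finite.subset (hP.subset hB₀)
    obtain ⟨z', hz', hd⟩ := ihd
    obtain ⟨z, hz, hr⟩ := ihr
    obtain ⟨B, hB, hB0, hdvd⟩ := exists_product_dvd (hP.subset hB₀) hH₀ bij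
    have hsub : ∀ C ∈ P \ {B₀}, C ⊆ A.hyperplanes \ B₀ := fun C hC H hH =>
      ⟨hP.subset hC.1 hH, fun h => hC.2 (hP.eq_of_mem hC.1 hB₀ hH h)⟩
    have hinj : Set.InjOn (fun C => interIn (LinearMap.ker α) '' C) (P \ {B₀}) :=
      fun C hC D hD e => (bij.injOn.image_eq_image_iff (hsub C hC) (hsub D hD)).1 e
    rw [blockSizes_image hinj fun C hC => (bij.injOn.mono (hsub C hC)).ncard_image] at hr
    rw [hinj.ncard_image] at hz
    have hcard := Set.ncard_sdiff_singleton_add_one hB₀ hPf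
    have hdim : Module.finrank K (LinearMap.ker α) + 1 = Module.finrank K V := by
      have := (LinearMap.ker α).finrank_quotient_add_finrank
      rw [finrank_quotient_eq_one (A.isCoatom _ hα)] at this
      omega
    have hN := Set.ncard_sdiff_singleton_add_one hH₀ hBf
    refine ⟨z, by omega, ?_⟩
    rw [blockSizes_eq_cons hB₀ hPf, Multiset.cons_add, ← hN]
    refine HasHomogeneousBasis.addition hα hB hB0 hdvd ?_ hr
    have hi := inducedPartition_sdiff_singleton hP hB₀ hH₀
    change inducedPartition P (A.deletion (LinearMap.ker α)).hyperplanes = _ at hi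
    rw [hi] at hd hz'
    -- If `H₀` is alone in its block, the block disappears from the deletion and `N = 0` is supplied
    -- by an additional zero exponent there, `z' = z + 1`. Otherwise the block only shrinks and `z'
    -- = z`.
    by_cases he : B₀ \ {LinearMap.ker α} = ∅
    · have h0 : {C | C.Nonempty ∧ C = B₀ \ {LinearMap.ker α}} = ∅ := by
        rw [Set.eq_empty_iff_forall_notMem]
        rintro C ⟨h1, h2⟩
        exact h1.ne_empty (h2.trans he)
      rw [h0, Set.empty_union] at hd hz'
      have : z' = z + 1 := by omega
      rw [he, Set.ncard_empty]
      rwa [this, Multiset.replicate_succ, Multiset.add_cons] at hd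
    · have h0 : {C | C.Nonempty ∧ C = B₀ \ {LinearMap.ker α}} = {B₀ \ {LinearMap.ker α}} := by
        ext C
        constructor
        · exact fun h => h.2
        · rintro rfl
          exact ⟨Set.nonempty_iff_ne_empty.2 he, rfl⟩
      have hnot : B₀ \ {LinearMap.ker α} ∉ P \ {B₀} := by
        rintro ⟨h1, h2⟩
        obtain ⟨H, hH⟩ := hP.nonempty h1
        exact h2 (hP.eq_of_mem h1 hB₀ hH hH.1)
      have hf : (P \ {B₀}).Finite := hPf.subset Set.sdiff_subset
      rw [h0, Set.singleton_union] at hd hz'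
      rw [Set.ncard_insert_of_notMem hnot hf] at hz'
      have : z' = z := by omega
      rwa [this, blockSizes_insert hnot hf, Multiset.cons_add] at hd

theorem blockSizes_gluePartition {V : Type u} [AddCommGroup V] [Module K V]
    {V₁ : Type v} [AddCommGroup V₁] [Module K V₁] {V₂ : Type v'} [AddCommGroup V₂] [Module K V₂]
    {A₁ : HyperplaneArrangement K V₁} {A₂ : HyperplaneArrangement K V₂}
    {P₁ : Set (Set (Submodule K V₁))} {P₂ : Set (Set (Submodule K V₂))}
    (h₁ : IsPartitionOf P₁ A₁.hyperplanes) (h₂ : IsPartitionOf P₂ A₂.hyperplanes)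
    {f₁ : V →ₗ[K] V₁} {f₂ : V →ₗ[K] V₂} (hf : Function.Surjective (f₁.prod f₂)) :
    blockSizes (gluePartition P₁ P₂ f₁ f₂) = blockSizes P₁ + blockSizes P₂ ∧
      (gluePartition P₁ P₂ f₁ f₂).ncard = P₁.ncard + P₂.ncard := by
  have i₁ := Submodule.comap_injective_of_surjective (surjective_fst_of_prod hf)
  have i₂ := Submodule.comap_injective_of_surjective (surjective_snd_of_prod hf)
  have hd := disjoint_gluePartition (P₁ := P₁) h₂ hf
  have hf₁ := (h₁.finite A₁.finite).image (Set.image (Submodule.comap f₁))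
  have hf₂ := (h₂.finite A₂.finite).image (Set.image (Submodule.comap f₂))
  constructor
  · rw [← blockSizes_image (Set.image_injective.2 i₁).injOn (P := P₁)
      fun B _ => Set.ncard_image_of_injective _ i₁,
      ← blockSizes_image (Set.image_injective.2 i₂).injOn (P := P₂)
      fun B _ => Set.ncard_image_of_injective _ i₂]
    exact finsum_mem_union hd hf₁ hf₂
  · rw [gluePartition, Set.ncard_union_eq hd hf₁ hf₂,
      Set.ncard_image_of_injective _ (Set.image_injective.2 i₁),
      Set.ncard_image_of_injective _ (Set.image_injective.2 i₂)]

end HyperplaneArrangement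

/-! ### The theorem. -/

open HyperplaneArrangement in
theorem mainTheorem8 {K : Type w} [Field K] {V₁ : Type u} {V₂ : Type v}
    [AddCommGroup V₁] [Module K V₁] [FiniteDimensional K V₁]
    [AddCommGroup V₂] [Module K V₂] [FiniteDimensional K V₂]
    (A₁ : HyperplaneArrangement K V₁) (A₂ : HyperplaneArrangement K V₂) :
    ((A₁.prod A₂).IsHereditarilyFactored ↔
      A₁.IsHereditarilyFactored ∧ A₂.IsHereditarilyFactored) ∧
    ((A₁.prod A₂).IsHereditarilyInductivelyFactored ↔
      A₁.IsHereditarilyInductivelyFactored ∧ A₂.IsHereditarilyInductivelyFactored) ∧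
    ((A₁.prod A₂).IsInductivelyFactored →
      ∃ e₁ e₂ : Multiset ℕ, A₁.IsFreeWithExponents e₁ ∧ A₂.IsFreeWithExponents e₂ ∧
        (A₁.prod A₂).IsFreeWithExponents (e₁ + e₂)) := by
  have hf : Function.Surjective ((LinearMap.fst K V₁ V₂).prod (LinearMap.snd K V₁ V₂)) :=
    fun x => ⟨x, rfl⟩
  have hf' := surjective_prod_swap hf
  have hp : A₁.prod A₂ = A₁.glue A₂ _ _ hf := prod_eq_glue A₁ A₂
  have hc : A₁.glue A₂ _ _ hf = A₂.glue A₁ _ _ hf' := glue_comm _ _ _ _ _ _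
  rw [hp]
  refine ⟨⟨fun h => ⟨h.of_glue, (hc ▸ h).of_glue⟩, fun h => h.1.glue h.2 hf⟩,
    ⟨fun h => ⟨h.of_glue, (hc ▸ h).of_glue⟩, fun h => h.1.glue h.2 hf⟩, fun h => ?_⟩
  obtain ⟨P₁, hP₁⟩ := h.of_glue
  obtain ⟨P₂, hP₂⟩ := (hc ▸ h).of_glue
  obtain ⟨z₁, hz₁, hb₁⟩ := hP₁.hasHomogeneousBasis
  obtain ⟨z₂, hz₂, hb₂⟩ := hP₂.hasHomogeneousBasis
  -- The exponents of the product are read off from the glued factorization, so no decomposition of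
  -- its derivation module is needed.
  obtain ⟨z, hz, hb⟩ := (hP₁.glue hP₂ _ _ hf).hasHomogeneousBasis
  obtain ⟨hs, hn⟩ := blockSizes_gluePartition (isInductiveFactorization_isPartitionOf hP₁)
    (isInductiveFactorization_isPartitionOf hP₂) hf
  rw [hn, Module.finrank_prod] at hz
  have hzz : z = z₁ + z₂ := by omega
  refine ⟨_, _, hb₁.isFreeWithExponents, hb₂.isFreeWithExponents, ?_⟩
  rw [hs, hzz, Multiset.replicate_add, add_add_add_comm] at hb
  exact hb.isFreeWithExponents
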